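/- Let $d\ge 1$, let $\sigma>0$ be known, and write $p(z\mid\mu)=(2\pi\sigma^2)^{-d/2}\exp(-\|z-\mu\|^2/(2\sigma^2))$ for the density of $\mathrm N_d(\mu,\sigma^2I_d)$, where $\mu\in\mathbb R^d$ is unknown. Having observed $x\sim p(\cdot\mid\mu)$, one predicts an independent $y\sim p(\cdot\mid\mu)$ by a predictive density $\hat p(y\mid x)$, i.e. a jointly measurable function $\hat p\ge 0$ with $\int\hat p(y\mid x)\,dy=1$ for every $x$. The loss is the squared $L^2$ Wasserstein distance $$L(\mu,q)=W_2\big(p(\cdot\mid\mu),q\big)^2=\inf_{\gamma}\int\|u-v\|^2\,d\gamma(u,v),$$ the infimum being over all joint laws $\gamma$ with marginals $p(\cdot\mid\mu)$ and $q$, and the risk is $R(\mu,\hat p)=\int L(\mu,\hat p(\cdot\mid x))\,p(x\mid\mu)\,dx$ (values in $[0,\infty]$). A predictive density $\hat p_*$ is minimax if $\sup_\mu R(\mu,\hat p_*)\le\sup_\mu R(\mu,\hat p)$ for every predictive density $\hat p$. Let $\pi:\mathbb R^d\to[0,\infty]$ be a (possibly improper) prior density which is not identically $0$ and is superharmonic: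 it is lower semicontinuous, not identically $\infty$, and for every $x$ and every $r>0$ its mean over the ball $B(x,r)$ is at most $\pi(x)$. Then: 1. for every $x$ the posterior distribution $\pi(\mu\mid x)\propto p(x\mid\mu)\,\pi(\mu)$ is a well-defined probability distribution with a finite mean $\hat\mu^\pi(x)=\int\mu\,\pi(\mu\mid x)\,d\mu$; 2. a (generalized) Bayesian predictive density with respect to $\pi$ exists, namely the plug-in density $\hat p_\pi(y\mid x)=p(y\mid\hat\mu^\pi(x))$; here a predictive density $\hat p$ is called (generalized) Bayesian with respect to $\pi$ if, for almost every $x$, $\hat p(\cdot\mid x)$ minimizes the posterior expected loss $\int L(\mu,q)\,\pi(\mu\mid x)\,d\mu$ among all probability densities $q$ on $\mathbb R^d$; 3. every (generalized) Bayesian predictive density with respect to $\pi$ is minimax. -/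

import Mathlib

open MeasureTheory
open scoped ENNReal

namespace PredictiveDensity

/-- The `d`-dimensional Euclidean space. -/
abbrev E (d : ℕ) : Type := EuclideanSpace ℝ (Fin d)

/-- The `L²` Wasserstein distance of two measures on `ℝ^d`: the square root of the infimum of
`∫ ‖u - v‖² dγ(u, v)` over all joint laws `γ` with marginals `P` and `Q`. The value is `∞` when
no joint law has a finite cost. -/
noncomputable def wassersteinTwo {d : ℕ} (P Q : Measure (E d)) : ℝ≥0∞ :=
  (⨅ γ ∈ {γ : Measure (E d × E d) | γ.map Prod.fst = P ∧ γ.map Prod.snd = Q},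
    ∫⁻ z, edist z.1 z.2 ^ 2 ∂γ) ^ (1 / 2 : ℝ)

/-- The density at `z` of the normal distribution `N_d(μ, σ² I_d)`. -/
noncomputable def normalDensity {d : ℕ} (σ : ℝ) (μ z : E d) : ℝ≥0∞ :=
  ENNReal.ofReal
    ((2 * Real.pi * σ ^ 2) ^ (-(d : ℝ) / 2) * Real.exp (-‖z - μ‖ ^ 2 / (2 * σ ^ 2)))

/-- The distribution on `ℝ^d` with Lebesgue density `q`. -/
noncomputable def law {d : ℕ} (q : E d → ℝ≥0∞) : Measure (E d) :=
  volume.withDensity q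

/-- `q` is a probability density on `ℝ^d`. -/
structure IsDensity {d : ℕ} (q : E d → ℝ≥0∞) : Prop where
  measurable : Measurable q
  lintegral_eq_one : ∫⁻ y, q y = 1

/-- `p x y` is a predictive density: the density at `y` which is announced after `x` has
been observed. -/
structure IsPredictiveDensity {d : ℕ} (p : E d → E d → ℝ≥0∞) : Prop where
  measurable : Measurable (Function.uncurry p)
  lintegral_eq_one : ∀ x, ∫⁻ y, p x y = 1

/-- The `L²` Wasserstein loss of the announced density `q` when the future observation has the
distribution `N_d(μ, σ² I_d)`. -/
noncomputable def loss {d : ℕ} (σ : ℝ) (μ : E d) (q : E d → ℝ≥0∞) : ℝ≥0∞ :=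
  wassersteinTwo (law (normalDensity σ μ)) (law q) ^ 2

/-- The risk at `μ` of a predictive density, for `x ∼ N_d(μ, σ² I_d)`. -/
noncomputable def risk {d : ℕ} (σ : ℝ) (μ : E d) (p : E d → E d → ℝ≥0∞) : ℝ≥0∞ :=
  ∫⁻ x, loss σ μ (p x) * normalDensity σ μ x

/-- `p` minimizes the maximum risk among all predictive densities. -/
def IsMinimax {d : ℕ} (σ : ℝ) (p : E d → E d → ℝ≥0∞) : Prop :=
  IsPredictiveDensity p ∧
    ∀ q : E d → E d → ℝ≥0∞, IsPredictiveDensity q → (⨆ μ, risk σ μ p) ≤ ⨆ μ, risk σ μ q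

/-- Nonnegative superharmonic functions on `ℝ^d`, with the value `∞` allowed: lower
semicontinuous, not identically `∞`, and at every point at least the mean over each ball centred
there. -/
structure IsSuperharmonic {d : ℕ} (π : E d → ℝ≥0∞) : Prop where
  lowerSemicontinuous : LowerSemicontinuous π
  exists_ne_top : ∃ x, π x ≠ ∞
  laverage_ball_le : ∀ x r, 0 < r → (⨍⁻ y in Metric.ball x r, π y ∂volume) ≤ π x

/-- The posterior distribution of `μ` given `x ∼ N_d(μ, σ² I_d)`, for the prior with (possibly
improper) density `π`: the normalization of `p(x | μ) π(μ) dμ`. -/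
noncomputable def posterior {d : ℕ} (σ : ℝ) (π : E d → ℝ≥0∞) (x : E d) : Measure (E d) :=
  (∫⁻ μ, normalDensity σ μ x * π μ)⁻¹ •
    volume.withDensity (fun μ => normalDensity σ μ x * π μ)

/-- The posterior mean of `μ`. -/
noncomputable def posteriorMean {d : ℕ} (σ : ℝ) (π : E d → ℝ≥0∞) (x : E d) : E d :=
  ∫ μ, μ ∂(posterior σ π x)

/-- The plug-in predictive density of an estimator `m` of `μ`. -/
noncomputable def plugIn {d : ℕ} (σ : ℝ) (m : E d → E d) (x : E d) : E d → ℝ≥0∞ :=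
  normalDensity σ (m x)

/-- `p` is a (generalized) Bayesian predictive density with respect to the prior density `π`: for
almost every observation `x` the density `p x` minimizes the posterior expected loss. (For an
improper prior the integral of the risk against the prior may be infinite for every predictive
density, so the minimization is done observation by observation.) -/
def IsBayes {d : ℕ} (σ : ℝ) (π : E d → ℝ≥0∞) (p : E d → E d → ℝ≥0∞) : Prop :=
  IsPredictiveDensity p ∧
    ∀ᵐ x : E d, ∀ q : E d → ℝ≥0∞, IsDensity q →
      ∫⁻ μ, loss σ μ (p x) ∂(posterior σ π x) ≤ ∫⁻ μ, loss σ μ q ∂(posterior σ π x)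

end PredictiveDensity

/-!
Translating a law splits the squared Wasserstein distance into the squared distance of the means
and the squared distance after recentring. Hence the loss of a density `q` at `μ` is `‖μ - m‖²`,
with `m` the mean of `q`, plus a term that does not depend on `μ`; a minimizer of the posterior
expected loss has `m` equal to the posterior mean and the extra term equal to `0`. So every Bayesian
predictive density has the quadratic risk of the posterior mean, and every predictive density has
at least the quadratic risk of its mean as an estimator.

The lower bound `d σ²` on the supremum of the quadratic risk of an estimator comes from the Bayes
risks `d σ² τ² / (σ² + τ²)` for the priors `N(0, τ² I)`, with `τ → ∞`.

For the upper bound, the mean value inequality over balls extends to normal densities, so the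
marginal density decreases as the variance of the observation grows. With Jensen's inequality this
bounds the posterior second moment about `x` by `d σ²`. By Tweedie's formula the posterior
covariance is `σ²` times the derivative of the posterior mean, and Stein's unbiased estimate of the
risk of the posterior mean, twice the posterior variance plus `‖posterior mean - x‖²` minus `d σ²`,
is at most twice the posterior second moment about `x` minus `d σ²`, hence at most `d σ²`.
-/

namespace PredictiveDensity

open ProbabilityTheory Filter Topology
open scoped RealInnerProductSpace

section SecondMoments

variable {Ω F : Type*} [MeasurableSpace Ω] {P : Measure Ω} [NormedAddCommGroup F] {X : Ω → F}

lemma lintegral_enorm_sq_eq_ofReal_integral (hX : MemLp X 2 P) :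
    ∫⁻ ω, ‖X ω‖ₑ ^ 2 ∂P = ENNReal.ofReal (∫ ω, ‖X ω‖ ^ 2 ∂P) := by
  simpa [enorm_pow] using
    (ofReal_integral_norm_eq_lintegral_enorm (hX.integrable_norm_pow two_ne_zero)).symm

variable [InnerProductSpace ℝ F]

lemma integral_norm_sq_eq_sum_integral_inner_sq {ι : Type*} [Fintype ι]
    (b : OrthonormalBasis ι ℝ F) (hX : MemLp X 2 P) :
    ∫ ω, ‖X ω‖ ^ 2 ∂P = ∑ i, ∫ ω, ⟪b i, X ω⟫ ^ 2 ∂P := by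
  rw [← integral_finsetSum _ fun i _ => (hX.const_inner (b i)).integrable_sq]
  simp_rw [b.sum_sq_inner_right]

variable [CompleteSpace F] [IsProbabilityMeasure P]

lemma integral_norm_sub_sq (hX : MemLp X 2 P) (c : F) :
    ∫ ω, ‖X ω - c‖ ^ 2 ∂P = ∫ ω, ‖X ω - ∫ ω, X ω ∂P‖ ^ 2 ∂P + ‖∫ ω, X ω ∂P - c‖ ^ 2 := by
  set m := ∫ ω, X ω ∂P with hm
  have hX1 : Integrable X P := hX.integrable one_le_two
  have hcentred : Integrable (fun ω => X ω - m) P := hX1.sub (integrable_const m)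
  have hmean : ∫ ω, (X ω - m) ∂P = 0 := by
    rw [integral_sub hX1 (integrable_const m), ← hm]
    simp
  have hsq : Integrable (fun ω => ‖X ω - m‖ ^ 2) P :=
    (hX.sub (memLp_const m)).integrable_norm_pow two_ne_zero
  have hcross : Integrable (fun ω => 2 * ⟪m - c, X ω - m⟫) P :=
    (hcentred.const_inner (m - c)).const_mul 2
  have hexpand : ∀ ω, ‖X ω - c‖ ^ 2 =
      ‖X ω - m‖ ^ 2 + 2 * ⟪m - c, X ω - m⟫ + ‖m - c‖ ^ 2 := fun ω => by
    rw [← sub_add_sub_cancel (X ω) m c, norm_add_sq_real, real_inner_comm]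
  simp_rw [hexpand]
  rw [integral_add (by exact hsq.add hcross) (integrable_const _), integral_add hsq hcross,
    integral_const_mul, integral_inner hcentred, hmean]
  simp

lemma lintegral_enorm_sub_sq (hX : MemLp X 2 P) (c : F) :
    ∫⁻ ω, ‖X ω - c‖ₑ ^ 2 ∂P =
      ∫⁻ ω, ‖X ω - ∫ ω, X ω ∂P‖ₑ ^ 2 ∂P + ‖∫ ω, X ω ∂P - c‖ₑ ^ 2 := by
  have h (a : F) : ∫⁻ ω, ‖X ω - a‖ₑ ^ 2 ∂P = ENNReal.ofReal (∫ ω, ‖X ω - a‖ ^ 2 ∂P) :=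
    lintegral_enorm_sq_eq_ofReal_integral (hX.sub (memLp_const a))
  rw [h, h, integral_norm_sub_sq hX c, ENNReal.ofReal_add (by positivity) (by positivity),
    ENNReal.ofReal_pow (norm_nonneg _), ofReal_norm]

lemma variance_inner_add_sq (hX : MemLp X 2 P) (v c : F) :
    Var[fun ω => ⟪v, X ω⟫; P] + ⟪v, ∫ ω, X ω ∂P - c⟫ ^ 2 = ∫ ω, ⟪v, X ω - c⟫ ^ 2 ∂P := by
  have h := integral_norm_sub_sq (hX.const_inner v) ⟪v, c⟫
  rw [integral_inner (hX.integrable one_le_two)] at h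
  rw [variance_eq_integral (hX.const_inner v).aestronglyMeasurable.aemeasurable,
    integral_inner (hX.integrable one_le_two)]
  simpa only [Real.norm_eq_abs, sq_abs, inner_sub_right] using h.symm

end SecondMoments

variable {d : ℕ}

section Wasserstein

variable {P Q : Measure (E d)}

lemma wassersteinTwo_sq (P Q : Measure (E d)) :
    wassersteinTwo P Q ^ 2 = ⨅ γ ∈ {γ : Measure (E d × E d) |
      γ.map Prod.fst = P ∧ γ.map Prod.snd = Q}, ∫⁻ z, edist z.1 z.2 ^ 2 ∂γ := by
  rw [wassersteinTwo, ← ENNReal.rpow_natCast, ← ENNReal.rpow_mul]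
  norm_num

lemma wassersteinTwo_sq_le {γ : Measure (E d × E d)} (hP : γ.map Prod.fst = P)
    (hQ : γ.map Prod.snd = Q) : wassersteinTwo P Q ^ 2 ≤ ∫⁻ z, edist z.1 z.2 ^ 2 ∂γ := by
  rw [wassersteinTwo_sq]
  exact iInf₂_le γ ⟨hP, hQ⟩

lemma memLp_two_of_wassersteinTwo_sq_ne_top (hP : MemLp id 2 P)
    (h : wassersteinTwo P Q ^ 2 ≠ ∞) : MemLp id 2 Q := by
  rw [wassersteinTwo_sq, ← lt_top_iff_ne_top] at h
  simp only [iInf_lt_iff] at h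
  obtain ⟨γ, ⟨rfl, rfl⟩, hγ⟩ := h
  have hfst : MemLp (fun z : E d × E d => z.1) 2 γ :=
    hP.comp_measurePreserving ⟨measurable_fst, rfl⟩
  have hdiff : MemLp (fun z : E d × E d => z.1 - z.2) 2 γ := by
    refine ⟨by fun_prop, ?_⟩
    rw [eLpNorm_lt_top_iff_lintegral_rpow_enorm_lt_top (by norm_num) (by norm_num)]
    simpa [edist_eq_enorm_sub] using hγ
  refine (memLp_map_measure_iff (by fun_prop) (by fun_prop)).2 ?_
  exact (hfst.sub hdiff).ae_eq (.of_forall fun z => by simp)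

lemma wassersteinTwo_sq_map_add_right_le [IsProbabilityMeasure P] (w : E d) :
    wassersteinTwo P (P.map (· + w)) ^ 2 ≤ ‖w‖ₑ ^ 2 := by
  have hT : Measurable fun u : E d => (u, u + w) := by fun_prop
  have hfst : (P.map fun u => (u, u + w)).map Prod.fst = P :=
    (Measure.map_map measurable_fst hT).trans Measure.map_id
  have hsnd : (P.map fun u => (u, u + w)).map Prod.snd = P.map (· + w) :=
    Measure.map_map measurable_snd hT
  refine (wassersteinTwo_sq_le hfst hsnd).trans_eq ?_
  rw [lintegral_map (by fun_prop) hT]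
  simp [edist_eq_enorm_sub]

/- Translating the first marginal of a coupling by `w` keeps the variance of the difference of the
two coordinates and changes only its mean. -/
lemma wassersteinTwo_sq_map_add_left_le [IsProbabilityMeasure P] (hP : MemLp id 2 P)
    (hQ : MemLp id 2 Q) (w : E d) :
    wassersteinTwo (P.map (· + w)) Q ^ 2 + ‖∫ u, u ∂P - ∫ v, v ∂Q‖ₑ ^ 2 ≤
      wassersteinTwo P Q ^ 2 + ‖∫ u, u ∂P + w - ∫ v, v ∂Q‖ₑ ^ 2 := by
  rw [← tsub_le_iff_right, wassersteinTwo_sq P Q]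
  refine le_iInf₂ fun γ ⟨hfst, hsnd⟩ => ?_
  rw [tsub_le_iff_right]
  have : IsProbabilityMeasure (γ.map Prod.fst) := by rwa [hfst]
  have : IsProbabilityMeasure γ := Measure.isProbabilityMeasure_of_map Prod.fst
  have hu : MemLp (fun z : E d × E d => z.1) 2 γ :=
    (hfst ▸ hP).comp_measurePreserving ⟨measurable_fst, rfl⟩
  have hv : MemLp (fun z : E d × E d => z.2) 2 γ :=
    (hsnd ▸ hQ).comp_measurePreserving ⟨measurable_snd, rfl⟩
  have hmean : ∫ z, (z.1 - z.2) ∂γ = ∫ u, u ∂P - ∫ v, v ∂Q := by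
    rw [integral_sub (hu.integrable one_le_two) (hv.integrable one_le_two), ← hfst, ← hsnd,
      integral_map (by fun_prop) (by fun_prop), integral_map (by fun_prop) (by fun_prop)]
  have hshift : wassersteinTwo (P.map (· + w)) Q ^ 2 ≤ ∫⁻ z, ‖z.1 - z.2 - -w‖ₑ ^ 2 ∂γ := by
    have hT : Measurable fun z : E d × E d => (z.1 + w, z.2) := by fun_prop
    refine (wassersteinTwo_sq_le (γ := γ.map fun z => (z.1 + w, z.2)) ?_ ?_).trans_eq ?_
    · rw [← hfst, Measure.map_map measurable_fst hT, Measure.map_map (by fun_prop) measurable_fst]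
      rfl
    · rw [← hsnd, Measure.map_map measurable_snd hT]
      rfl
    · rw [lintegral_map (by fun_prop) hT]
      simp only [edist_eq_enorm_sub, sub_neg_eq_add, add_sub_right_comm]
  have hvar := lintegral_enorm_sub_sq (hu.sub hv)
  simp only [Pi.sub_apply, hmean] at hvar
  have hcost := hvar 0
  simp only [sub_zero] at hcost
  have hcost_shift := hvar (-w)
  rw [sub_neg_eq_add, ← add_sub_right_comm] at hcost_shift
  calc wassersteinTwo (P.map (· + w)) Q ^ 2 + ‖∫ u, u ∂P - ∫ v, v ∂Q‖ₑ ^ 2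
      ≤ ∫⁻ z, ‖z.1 - z.2 - -w‖ₑ ^ 2 ∂γ + ‖∫ u, u ∂P - ∫ v, v ∂Q‖ₑ ^ 2 := by gcongr
    _ = ∫⁻ z, edist z.1 z.2 ^ 2 ∂γ + ‖∫ u, u ∂P + w - ∫ v, v ∂Q‖ₑ ^ 2 := by
      simp_rw [edist_eq_enorm_sub]
      rw [hcost_shift, hcost, add_right_comm]

lemma wassersteinTwo_sq_eq_add [IsProbabilityMeasure P] (hP : MemLp id 2 P) (hQ : MemLp id 2 Q) :
    wassersteinTwo P Q ^ 2 =
      wassersteinTwo (P.map (· + (∫ v, v ∂Q - ∫ u, u ∂P))) Q ^ 2 +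
        ‖∫ u, u ∂P - ∫ v, v ∂Q‖ₑ ^ 2 := by
  set w := ∫ v, v ∂Q - ∫ u, u ∂P with hw
  have : IsProbabilityMeasure (P.map (· + w)) :=
    Measure.isProbabilityMeasure_map (by fun_prop)
  have hPw : MemLp id 2 (P.map (· + w)) :=
    (memLp_map_measure_iff (by fun_prop) (by fun_prop)).2 (hP.add (memLp_const w))
  have hmean : ∫ u, u ∂(P.map (· + w)) = ∫ v, v ∂Q := by
    rw [integral_map (by fun_prop) (by fun_prop),
      integral_add (f := fun u => u) (hP.integrable one_le_two) (integrable_const w)]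
    simp [hw]
  have hback : (P.map (· + w)).map (· + -w) = P := by
    rw [Measure.map_map (by fun_prop) (by fun_prop)]
    convert Measure.map_id
    ext1 u
    simp
  refine le_antisymm ?_ ?_
  · have h := wassersteinTwo_sq_map_add_left_le hPw hQ (-w)
    rw [hback, hmean] at h
    simpa [hw] using h
  · have h := wassersteinTwo_sq_map_add_left_le hP hQ w
    simpa [hw] using h

end Wasserstein

variable {σ τ : ℝ}

section NormalDensity

lemma measurable_uncurry_normalDensity :
    Measurable (Function.uncurry (normalDensity (d := d) σ)) := by
  apply Measurable.ennreal_ofReal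
  apply Continuous.measurable
  fun_prop

lemma measurable_normalDensity_left (x : E d) : Measurable fun μ => normalDensity σ μ x :=
  measurable_uncurry_normalDensity.of_uncurry_right

lemma measurable_normalDensity (μ : E d) : Measurable (normalDensity σ μ) :=
  measurable_uncurry_normalDensity.of_uncurry_left

lemma continuous_normalDensity_right (μ : E d) : Continuous (normalDensity σ μ) :=
  ENNReal.continuous_ofReal.comp (by fun_prop)

lemma normalDensity_comm (μ z : E d) : normalDensity σ μ z = normalDensity σ z μ := by
  simp only [normalDensity, norm_sub_rev]

lemma normalDensity_add_right_cancel (μ z v : E d) :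
    normalDensity σ (μ + v) (z + v) = normalDensity σ μ z := by
  simp only [normalDensity, add_sub_add_right_eq_sub]

lemma normalDensity_ne_top (μ z : E d) : normalDensity σ μ z ≠ ∞ := ENNReal.ofReal_ne_top

lemma normalDensity_ne_zero (hσ : 0 < σ) (μ z : E d) : normalDensity σ μ z ≠ 0 := by
  simp only [normalDensity, ne_eq, ENNReal.ofReal_eq_zero, not_le]
  positivity

lemma toReal_normalDensity (μ z : E d) : (normalDensity σ μ z).toReal =
    (2 * Real.pi * σ ^ 2) ^ (-(d : ℝ) / 2) * Real.exp (-‖z - μ‖ ^ 2 / (2 * σ ^ 2)) :=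
  ENNReal.toReal_ofReal (by positivity)

lemma lintegral_normalDensity (hσ : 0 < σ) (μ : E d) : ∫⁻ z, normalDensity σ μ z = 1 := by
  have hexponent (z : E d) : -‖z‖ ^ 2 / (2 * σ ^ 2) = -(1 / (2 * σ ^ 2)) * ‖z‖ ^ 2 := by ring
  have hgauss := GaussianFourier.integral_rexp_neg_mul_sq_norm (V := E d)
    (show 0 < 1 / (2 * σ ^ 2) by positivity)
  have hint : Integrable fun z : E d => Real.exp (-(1 / (2 * σ ^ 2)) * ‖z‖ ^ 2) :=
    .of_integral_ne_zero (by rw [hgauss]; positivity)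
  unfold normalDensity
  rw [lintegral_sub_right_eq_self (μ := volume) (fun z : E d => ENNReal.ofReal
    ((2 * Real.pi * σ ^ 2) ^ (-(d : ℝ) / 2) * Real.exp (-‖z‖ ^ 2 / (2 * σ ^ 2)))) μ]
  simp_rw [hexponent]
  rw [← ofReal_integral_eq_lintegral_ofReal (hint.const_mul _) (.of_forall fun z => by positivity),
    integral_const_mul, hgauss, finrank_euclideanSpace_fin,
    show Real.pi / (1 / (2 * σ ^ 2)) = 2 * Real.pi * σ ^ 2 by field_simp,
    ← Real.rpow_add (by positivity)]
  simp [neg_div]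

lemma norm_sub_sq_div_add_norm_sub_sq_div {F : Type*} [NormedAddCommGroup F]
    [InnerProductSpace ℝ F] {a b : ℝ} (ha : 0 < a) (hb : 0 < b) (x c μ : F) :
    ‖x - μ‖ ^ 2 / a + ‖μ - c‖ ^ 2 / b =
      ‖x - c‖ ^ 2 / (a + b) + ‖μ - (c + (b / (a + b)) • (x - c))‖ ^ 2 / (a * b / (a + b)) := by
  rw [show x - μ = (x - c) - (μ - c) by abel,
    show μ - (c + (b / (a + b)) • (x - c)) = (μ - c) - (b / (a + b)) • (x - c) by abel]
  generalize x - c = u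
  generalize μ - c = v
  rw [norm_sub_sq_real, norm_sub_sq_real, norm_smul, inner_smul_right, real_inner_comm u v,
    mul_pow, Real.norm_eq_abs, sq_abs]
  field_simp
  ring

/- The left-hand side is the joint density at `(μ, x)` for the prior `N(c, τ² I)`, the right-hand
side its factorization into the marginal of `x` and the posterior of `μ`. -/
lemma normalDensity_mul_normalDensity {s ρ : ℝ} (hσ : 0 < σ) (hτ : 0 < τ) (hs : 0 < s)
    (hs_sq : s ^ 2 = σ ^ 2 + τ ^ 2) (hρ : ρ = σ * τ / s) (x c μ : E d) :
    normalDensity σ μ x * normalDensity τ c μ =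
      normalDensity s c x * normalDensity ρ (c + (τ ^ 2 / s ^ 2) • (x - c)) μ := by
  have hρ_sq : ρ ^ 2 = σ ^ 2 * τ ^ 2 / s ^ 2 := by rw [hρ, div_pow, mul_pow]
  have hconst :
      (2 * Real.pi * σ ^ 2) ^ (-(d : ℝ) / 2) * (2 * Real.pi * τ ^ 2) ^ (-(d : ℝ) / 2) =
        (2 * Real.pi * s ^ 2) ^ (-(d : ℝ) / 2) * (2 * Real.pi * ρ ^ 2) ^ (-(d : ℝ) / 2) := by
    rw [← Real.mul_rpow (by positivity) (by positivity),
      ← Real.mul_rpow (by positivity) (by positivity), hρ_sq]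
    congr 1
    field_simp
  have hexponent : -‖x - μ‖ ^ 2 / (2 * σ ^ 2) + -‖μ - c‖ ^ 2 / (2 * τ ^ 2) =
      -‖x - c‖ ^ 2 / (2 * s ^ 2) +
        -‖μ - (c + (τ ^ 2 / s ^ 2) • (x - c))‖ ^ 2 / (2 * ρ ^ 2) := by
    have h := norm_sub_sq_div_add_norm_sub_sq_div (sq_pos_of_pos hσ) (sq_pos_of_pos hτ) x c μ
    rw [← hs_sq, ← hρ_sq] at h
    rw [div_mul_eq_div_div_swap, div_mul_eq_div_div_swap, div_mul_eq_div_div_swap,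
      div_mul_eq_div_div_swap, neg_div, neg_div, neg_div, neg_div]
    linear_combination (-1 / 2) * h
  unfold normalDensity
  rw [← ENNReal.ofReal_mul (by positivity), ← ENNReal.ofReal_mul (by positivity),
    mul_mul_mul_comm, ← Real.exp_add, hconst, hexponent, Real.exp_add, mul_mul_mul_comm]

lemma lintegral_normalDensity_mul_normalDensity (hσ : 0 < σ) (hτ : 0 < τ) (x c : E d) :
    ∫⁻ μ, normalDensity σ μ x * normalDensity τ c μ = normalDensity √(σ ^ 2 + τ ^ 2) c x := by
  have hs : 0 < √(σ ^ 2 + τ ^ 2) := by positivity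
  have hsq : √(σ ^ 2 + τ ^ 2) ^ 2 = σ ^ 2 + τ ^ 2 := Real.sq_sqrt (by positivity)
  simp_rw [fun μ => normalDensity_mul_normalDensity hσ hτ hs hsq rfl x c μ]
  rw [lintegral_const_mul _ (measurable_normalDensity _),
    lintegral_normalDensity (by positivity), mul_one]

lemma normalDensity_add_right (hσ : 0 < σ) (μ x v : E d) :
    normalDensity σ μ (x + v) =
      ENNReal.ofReal (Real.exp (-(2 * ⟪x, v⟫ + ‖v‖ ^ 2) / (2 * σ ^ 2))) *
        (normalDensity σ μ x * ENNReal.ofReal (Real.exp (⟪v, μ⟫ / σ ^ 2))) := by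
  unfold normalDensity
  rw [← ENNReal.ofReal_mul (by positivity), ← ENNReal.ofReal_mul (by positivity)]
  congr 1
  generalize (2 * Real.pi * σ ^ 2) ^ (-(d : ℝ) / 2) = c
  rw [mul_assoc, mul_left_comm, ← Real.exp_add, ← Real.exp_add]
  congr 2
  rw [add_sub_right_comm, norm_add_sq_real, inner_sub_left, real_inner_comm v μ]
  field_simp
  ring

/- Parallelogram law in the exponent, then `2 √(ab) ≤ a + b`. -/
lemma normalDensity_le_mul_add (μ x v : E d) :
    normalDensity σ μ x ≤ ENNReal.ofReal (Real.exp (‖v‖ ^ 2 / (2 * σ ^ 2))) *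
      (normalDensity σ μ (x + v) + normalDensity σ μ (x - v)) := by
  unfold normalDensity
  rw [← ENNReal.ofReal_add (by positivity) (by positivity), ← mul_add,
    ← ENNReal.ofReal_mul (by positivity), mul_left_comm]
  refine ENNReal.ofReal_le_ofReal (mul_le_mul_of_nonneg_left ?_ (by positivity))
  set a := -‖x + v - μ‖ ^ 2 / (2 * σ ^ 2)
  set b := -‖x - v - μ‖ ^ 2 / (2 * σ ^ 2)
  have hexponent : -‖x - μ‖ ^ 2 / (2 * σ ^ 2) = ‖v‖ ^ 2 / (2 * σ ^ 2) + (a + b) / 2 := by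
    have h := parallelogram_law_with_norm ℝ (x - μ) v
    rw [← add_sub_right_comm, sub_right_comm] at h
    simp only [a, b]
    linear_combination (1 / (4 * σ ^ 2)) * h
  have hamgm : Real.exp ((a + b) / 2) ≤ Real.exp a + Real.exp b := by
    rcases le_total a b with hab | hab
    · exact (Real.exp_le_exp.2 (by linarith)).trans (le_add_of_nonneg_left (Real.exp_pos a).le)
    · exact (Real.exp_le_exp.2 (by linarith)).trans (le_add_of_nonneg_right (Real.exp_pos b).le)
  rw [hexponent, Real.exp_add]
  gcongr

lemma normalDensity_mul_exp_le {s : ℝ} (hσ : 0 < σ) (hs : 0 < s) (μ x : E d) :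
    normalDensity σ μ x * ENNReal.ofReal
        (Real.exp ((s ^ 2 - σ ^ 2) / (2 * σ ^ 2) * (‖μ - x‖ ^ 2 / s ^ 2 - d))) ≤
      normalDensity s μ x := by
  have hlog : Real.log (s ^ 2) - Real.log (σ ^ 2) ≤ s ^ 2 / σ ^ 2 - 1 := by
    rw [← Real.log_div (by positivity) (by positivity)]
    exact Real.log_le_sub_one_of_pos (by positivity)
  unfold normalDensity
  rw [← ENNReal.ofReal_mul (by positivity), Real.rpow_def_of_pos (by positivity),
    Real.rpow_def_of_pos (by positivity), ← Real.exp_add, ← Real.exp_add, ← Real.exp_add,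
    Real.log_mul (by positivity) (by positivity), Real.log_mul (x := 2 * Real.pi) (by positivity)
    (by positivity), norm_sub_rev x μ]
  refine ENNReal.ofReal_le_ofReal (Real.exp_le_exp.2 ?_)
  have hgap : (Real.log (2 * Real.pi) + Real.log (s ^ 2)) * (-d / 2) +
        -‖μ - x‖ ^ 2 / (2 * s ^ 2) -
      ((Real.log (2 * Real.pi) + Real.log (σ ^ 2)) * (-d / 2) + -‖μ - x‖ ^ 2 / (2 * σ ^ 2) +
        (s ^ 2 - σ ^ 2) / (2 * σ ^ 2) * (‖μ - x‖ ^ 2 / s ^ 2 - d)) =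
      d / 2 * (s ^ 2 / σ ^ 2 - 1 - (Real.log (s ^ 2) - Real.log (σ ^ 2))) := by
    field_simp
    ring
  rw [← sub_nonneg, hgap]
  exact mul_nonneg (by positivity) (sub_nonneg.2 hlog)

lemma hasLineDerivAt_normalDensity (hσ : 0 < σ) (μ z v : E d) :
    HasLineDerivAt ℝ (fun z => (normalDensity σ μ z).toReal)
      (-⟪v, z - μ⟫ / σ ^ 2 * (normalDensity σ μ z).toReal) z v := by
  have hnorm : HasFDerivAt (fun z => ‖z - μ‖ ^ 2) (2 • (innerSL ℝ (z - μ))) z := by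
    simpa using ((hasFDerivAt_id z).sub_const μ).norm_sq
  have hderiv := ((hnorm.neg.mul_const (2 * σ ^ 2)⁻¹).exp.const_mul
    ((2 * Real.pi * σ ^ 2) ^ (-(d : ℝ) / 2))).hasLineDerivAt v
  simp_rw [toReal_normalDensity, div_eq_mul_inv _ (2 * σ ^ 2)]
  refine (congrArg (HasLineDerivAt ℝ _ · z v) ?_).mp hderiv
  simp only [Pi.neg_apply, smul_apply, neg_apply,
    innerSL_apply_apply, real_inner_comm v, smul_eq_mul, nsmul_eq_mul]
  field_simp
  norm_num

end NormalDensity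

section NormalLaw

lemma IsDensity.isProbabilityMeasure_law {q : E d → ℝ≥0∞} (hq : IsDensity q) :
    IsProbabilityMeasure (law q) := by
  constructor
  rw [law, withDensity_apply _ MeasurableSet.univ, setLIntegral_univ, hq.lintegral_eq_one]

lemma isDensity_normalDensity (hσ : 0 < σ) (μ : E d) : IsDensity (normalDensity σ μ) :=
  ⟨measurable_normalDensity μ, lintegral_normalDensity hσ μ⟩

lemma isProbabilityMeasure_law_normalDensity (hσ : 0 < σ) (μ : E d) :
    IsProbabilityMeasure (law (normalDensity σ μ)) :=
  (isDensity_normalDensity hσ μ).isProbabilityMeasure_law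

lemma lintegral_law {q f : E d → ℝ≥0∞} (hq : Measurable q) (hf : Measurable f) :
    ∫⁻ z, f z ∂(law q) = ∫⁻ z, f z * q z := by
  rw [law, lintegral_withDensity_eq_lintegral_mul _ hq hf]
  simp_rw [Pi.mul_apply, mul_comm]

lemma integral_law_normalDensity (μ : E d) (f : E d → ℝ) :
    ∫ z, f z ∂(law (normalDensity σ μ)) = ∫ z, (normalDensity σ μ z).toReal * f z :=
  integral_withDensity_eq_integral_toReal_smul (measurable_normalDensity μ)
    (.of_forall fun _ => (normalDensity_ne_top _ _).lt_top) f

lemma integrable_law_normalDensity_iff (μ : E d) (f : E d → ℝ) :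
    Integrable f (law (normalDensity σ μ)) ↔
      Integrable fun z => (normalDensity σ μ z).toReal * f z :=
  integrable_withDensity_iff_integrable_smul' (measurable_normalDensity μ)
    (.of_forall fun _ => (normalDensity_ne_top _ _).lt_top)

lemma map_add_law_normalDensity (μ v : E d) :
    (law (normalDensity σ μ)).map (· + v) = law (normalDensity σ (μ + v)) := by
  ext s hs
  have hs' : MeasurableSet ((· + v) ⁻¹' s) := measurable_add_const v hs
  rw [Measure.map_apply (measurable_add_const v) hs, law, law, withDensity_apply _ hs',
    withDensity_apply _ hs, ← lintegral_indicator hs', ← lintegral_indicator hs,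
    ← lintegral_add_right_eq_self (s.indicator _) v]
  refine lintegral_congr fun z => ?_
  simp only [Set.indicator, normalDensity_add_right_cancel]
  rfl

end NormalLaw

section Superharmonic

variable {π : E d → ℝ≥0∞}

lemma IsSuperharmonic.measurable (hπ : IsSuperharmonic π) : Measurable π :=
  hπ.lowerSemicontinuous.measurable

lemma IsSuperharmonic.setLIntegral_ball_le (hπ : IsSuperharmonic π) (x : E d) (r : ℝ) :
    ∫⁻ y in Metric.ball x r, π y ≤ π x * volume (Metric.ball x r) := by
  rcases le_or_gt r 0 with hr | hr
  · simp [Metric.ball_eq_empty.2 hr]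
  · have h := hπ.laverage_ball_le x r hr
    rwa [setLAverage_eq, ENNReal.div_le_iff (Metric.measure_ball_pos volume x hr).ne'
      measure_ball_lt_top.ne] at h

lemma IsSuperharmonic.ae_ne_top (hπ : IsSuperharmonic π) : ∀ᵐ x, π x ≠ ∞ := by
  obtain ⟨x, hx⟩ := hπ.exists_ne_top
  have hball (n : ℕ) : ∀ᵐ y ∂volume.restrict (Metric.ball x n), π y ≠ ∞ := by
    refine (ae_lt_top hπ.measurable ?_).mono fun y => LT.lt.ne
    exact ne_top_of_le_ne_top (ENNReal.mul_ne_top hx measure_ball_lt_top.ne)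
      (hπ.setLIntegral_ball_le x n)
  rw [← Measure.restrict_univ (μ := (volume : Measure (E d))), ← Metric.iUnion_ball_nat x,
    ae_restrict_iUnion_iff]
  exact hball

lemma IsSuperharmonic.lintegral_mul_le (hπ : IsSuperharmonic π) {f : E d → ℝ} (hf : Measurable f)
    (hf_nonneg : ∀ y, 0 ≤ f y) {x : E d}
    (hball : ∀ t, 0 < t → ∃ r, {y | t < f y} = Metric.ball x r) :
    ∫⁻ y, ENNReal.ofReal (f y) * π y ≤ (∫⁻ y, ENNReal.ofReal (f y)) * π x := by
  have layercake (ν : Measure (E d)) :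
      ∫⁻ y, ENNReal.ofReal (f y) ∂ν = ∫⁻ t in Set.Ioi (0 : ℝ), ν {y | t < f y} :=
    lintegral_eq_lintegral_meas_lt ν (.of_forall hf_nonneg) hf.aemeasurable
  have hlevel (t : ℝ) (ht : t ∈ Set.Ioi 0) :
      volume.withDensity π {y | t < f y} ≤ (π x • volume : Measure (E d)) {y | t < f y} := by
    obtain ⟨r, hr⟩ := hball t ht
    rw [hr, withDensity_apply _ measurableSet_ball, Measure.smul_apply, smul_eq_mul]
    exact hπ.setLIntegral_ball_le x r
  calc ∫⁻ y, ENNReal.ofReal (f y) * π y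
      = ∫⁻ y, ENNReal.ofReal (f y) ∂(volume.withDensity π) := by
        rw [lintegral_withDensity_eq_lintegral_mul _ hπ.measurable hf.ennreal_ofReal]
        simp_rw [Pi.mul_apply, mul_comm]
    _ ≤ ∫⁻ y, ENNReal.ofReal (f y) ∂(π x • volume) := by
        rw [layercake, layercake]
        exact setLIntegral_mono' measurableSet_Ioi hlevel
    _ = (∫⁻ y, ENNReal.ofReal (f y)) * π x := by
        rw [lintegral_smul_measure, smul_eq_mul, mul_comm]

lemma setOf_lt_normalDensity_eq_ball (hσ : 0 < σ) (x : E d) {t : ℝ} (ht : 0 < t) :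
    {μ | t < (normalDensity σ μ x).toReal} = Metric.ball x
      √(2 * σ ^ 2 * Real.log ((2 * Real.pi * σ ^ 2) ^ (-(d : ℝ) / 2) / t)) := by
  ext μ
  have hc : 0 < (2 * Real.pi * σ ^ 2) ^ (-(d : ℝ) / 2) := by positivity
  rw [Set.mem_ofPred_eq, Metric.mem_ball, dist_eq_norm, toReal_normalDensity,
    Real.lt_sqrt (norm_nonneg _), norm_sub_rev μ x, ← div_lt_iff₀' hc,
    ← Real.log_lt_iff_lt_exp (div_pos ht hc), neg_div _ (‖x - μ‖ ^ 2), lt_neg, ← Real.log_inv,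
    inv_div, div_lt_iff₀ (by positivity), mul_comm (2 * σ ^ 2)]

end Superharmonic

section Marginal

/-- The density of the observation when the parameter has the (possibly improper) prior density
`π`; as a function of `σ ^ 2` it is the heat semigroup applied to `π`. -/
noncomputable def marginal (σ : ℝ) (π : E d → ℝ≥0∞) (x : E d) : ℝ≥0∞ :=
  ∫⁻ μ, normalDensity σ μ x * π μ

variable {π : E d → ℝ≥0∞}

lemma measurable_normalDensity_mul (hπ : Measurable π) (x : E d) :
    Measurable fun μ => normalDensity σ μ x * π μ :=
  (measurable_normalDensity_left x).mul hπ

lemma IsSuperharmonic.marginal_le (hπ : IsSuperharmonic π) (hσ : 0 < σ) (x : E d) :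
    marginal σ π x ≤ π x := by
  have h := hπ.lintegral_mul_le (measurable_normalDensity_left (σ := σ) x).ennreal_toReal
    (fun _ => ENNReal.toReal_nonneg) fun t ht => ⟨_, setOf_lt_normalDensity_eq_ball hσ x ht⟩
  simp_rw [ENNReal.ofReal_toReal (normalDensity_ne_top _ _), normalDensity_comm _ x] at h
  rw [lintegral_normalDensity hσ, one_mul] at h
  simpa only [marginal, normalDensity_comm _ x] using h

lemma marginal_marginal (hσ : 0 < σ) (hτ : 0 < τ) (hπ : Measurable π) (x : E d) :
    marginal σ (marginal τ π) x = marginal √(σ ^ 2 + τ ^ 2) π x := by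
  calc marginal σ (marginal τ π) x
      = ∫⁻ z, ∫⁻ μ, normalDensity σ z x * normalDensity τ μ z * π μ := by
        refine lintegral_congr fun z => ?_
        simp_rw [mul_assoc]
        exact (lintegral_const_mul _ (measurable_normalDensity_mul hπ z)).symm
    _ = ∫⁻ μ, ∫⁻ z, normalDensity σ z x * normalDensity τ μ z * π μ := by
        refine lintegral_lintegral_swap (Measurable.aemeasurable ?_)
        exact (((measurable_normalDensity_left x).comp measurable_fst).mul
          (measurable_uncurry_normalDensity.comp measurable_swap)).mul (hπ.comp measurable_snd)
    _ = marginal √(σ ^ 2 + τ ^ 2) π x := by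
        refine lintegral_congr fun μ => ?_
        rw [← lintegral_normalDensity_mul_normalDensity hσ hτ]
        exact lintegral_mul_const _
          ((measurable_normalDensity_left x).mul (measurable_normalDensity μ))

lemma marginal_eq_lintegral_add (π : E d → ℝ≥0∞) (x : E d) :
    marginal σ π x = ∫⁻ z, normalDensity σ 0 z * π (x + z) := by
  rw [marginal, ← lintegral_add_left_eq_self _ x]
  refine lintegral_congr fun z => ?_
  rw [normalDensity_comm, ← normalDensity_add_right_cancel 0 z x, zero_add, add_comm z]

lemma lowerSemicontinuous_marginal (hσ : 0 < σ) (hπ : Measurable π) :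
    LowerSemicontinuous (marginal σ π) := by
  refine lowerSemicontinuous_iff_le_liminf.2 fun x => ?_
  have hlim (μ : E d) : Tendsto (fun y => normalDensity σ μ y * π μ) (𝓝 x)
      (𝓝 (normalDensity σ μ x * π μ)) :=
    ENNReal.Tendsto.mul_const ((continuous_normalDensity_right μ).tendsto x)
      (.inl (normalDensity_ne_zero hσ μ x))
  calc marginal σ π x
      = ∫⁻ μ, liminf (fun y => normalDensity σ μ y * π μ) (𝓝 x) :=
        lintegral_congr fun μ => (hlim μ).liminf_eq.symm
    _ ≤ liminf (marginal σ π) (𝓝 x) :=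
        lintegral_liminf_le fun y => measurable_normalDensity_mul hπ y

lemma IsSuperharmonic.marginal (hπ : IsSuperharmonic π) (hσ : 0 < σ) :
    IsSuperharmonic (marginal σ π) where
  lowerSemicontinuous := lowerSemicontinuous_marginal hσ hπ.measurable
  exists_ne_top := by
    obtain ⟨x, hx⟩ := hπ.exists_ne_top
    exact ⟨x, ne_top_of_le_ne_top hx (hπ.marginal_le hσ x)⟩
  laverage_ball_le x r hr := by
    have hshift (z : E d) : ∫⁻ y in Metric.ball x r, π (y + z) ≤
        π (x + z) * volume (Metric.ball x r) := by
      have h := hπ.setLIntegral_ball_le (x + z) r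
      rw [← (measurePreserving_add_right volume z).setLIntegral_comp_preimage measurableSet_ball
        hπ.measurable, Measure.addHaar_ball_center] at h
      rw [Measure.addHaar_ball_center]
      simpa using h
    rw [setLAverage_eq, ENNReal.div_le_iff (Metric.measure_ball_pos volume x hr).ne'
      measure_ball_lt_top.ne]
    simp_rw [marginal_eq_lintegral_add]
    calc ∫⁻ y in Metric.ball x r, ∫⁻ z, normalDensity σ 0 z * π (y + z)
        = ∫⁻ z, normalDensity σ 0 z * ∫⁻ y in Metric.ball x r, π (y + z) := by
          rw [lintegral_lintegral_swap]
          · refine lintegral_congr fun z => lintegral_const_mul _ ?_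
            exact hπ.measurable.comp (measurable_add_const z)
          · refine Measurable.aemeasurable ?_
            exact ((measurable_normalDensity 0).comp measurable_snd).mul
              (hπ.measurable.comp measurable_add)
      _ ≤ ∫⁻ z, normalDensity σ 0 z * (π (x + z) * volume (Metric.ball x r)) := by
          gcongr with z
          exact hshift z
      _ = (∫⁻ z, normalDensity σ 0 z * π (x + z)) * volume (Metric.ball x r) := by
          simp_rw [← mul_assoc]
          exact lintegral_mul_const' _ _ measure_ball_lt_top.ne

lemma marginal_ne_top_of_ae (hπ : Measurable π) (h : ∀ᵐ x, marginal σ π x ≠ ∞) (x : E d) :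
    marginal σ π x ≠ ∞ := by
  have hadd : ∀ᵐ v, marginal σ π (x + v) ≠ ∞ :=
    (measurePreserving_add_left volume x).quasiMeasurePreserving.ae h
  have hsub : ∀ᵐ v, marginal σ π (x - v) ≠ ∞ :=
    (quasiMeasurePreserving_sub_left volume x).ae h
  obtain ⟨v, hv_add, hv_sub⟩ := (hadd.and hsub).exists
  set K := ENNReal.ofReal (Real.exp (‖v‖ ^ 2 / (2 * σ ^ 2)))
  have hle : marginal σ π x ≤ K * (marginal σ π (x + v) + marginal σ π (x - v)) := by
    have hm := measurable_normalDensity_mul (σ := σ) hπ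
    rw [marginal, marginal, marginal, ← lintegral_add_left (hm (x + v)),
      ← lintegral_const_mul' _ _ ENNReal.ofReal_ne_top]
    refine lintegral_mono fun μ => ?_
    rw [← add_mul, ← mul_assoc]
    gcongr
    exact normalDensity_le_mul_add μ x v
  exact ne_top_of_le_ne_top
    (ENNReal.mul_ne_top ENNReal.ofReal_ne_top (ENNReal.add_ne_top.2 ⟨hv_add, hv_sub⟩)) hle

lemma marginal_eq_zero_iff (hσ : 0 < σ) (hπ : Measurable π) {x : E d} :
    marginal σ π x = 0 ↔ π =ᵐ[volume] 0 := by
  rw [marginal, lintegral_eq_zero_iff (measurable_normalDensity_mul hπ x)]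
  exact eventually_congr (.of_forall fun μ => by simp [normalDensity_ne_zero hσ])

lemma marginal_one (hσ : 0 < σ) (x : E d) : marginal σ 1 x = 1 := by
  simp_rw [marginal, normalDensity_comm _ x, Pi.one_apply, mul_one, lintegral_normalDensity hσ]

lemma IsSuperharmonic.not_ae_eq_zero (hπ : IsSuperharmonic π) (h : ∃ μ, π μ ≠ 0) :
    ¬ π =ᵐ[volume] 0 := fun hzero => by
  obtain ⟨μ, hμ⟩ := h
  have hopen : IsOpen {μ | 0 < π μ} := hπ.lowerSemicontinuous.isOpen_preimage 0
  refine (hopen.measure_pos volume ⟨μ, pos_iff_ne_zero.2 hμ⟩).ne' ?_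
  exact measure_mono_null (fun ν hν => ne_of_gt hν) hzero

end Marginal

section Tilting

variable {Ω : Type*} [MeasurableSpace Ω] {P Q : Measure Ω} [IsProbabilityMeasure P]
  {f : Ω → ℝ} {a : ℝ≥0∞}

lemma mul_lintegral_exp_eq_one
    (h : P = a • Q.withDensity fun ω => ENNReal.ofReal (Real.exp (f ω))) :
    a * ∫⁻ ω, ENNReal.ofReal (Real.exp (f ω)) ∂Q = 1 := by
  have := measure_univ (μ := P)
  rwa [h, Measure.smul_apply, withDensity_apply _ MeasurableSet.univ, setLIntegral_univ] at this

lemma integrable_exp_of_eq_smul_withDensity (hf : Measurable f)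
    (h : P = a • Q.withDensity fun ω => ENNReal.ofReal (Real.exp (f ω))) :
    Integrable (fun ω => Real.exp (f ω)) Q := by
  have hone := mul_lintegral_exp_eq_one h
  refine (lintegral_ofReal_ne_top_iff_integrable hf.exp.aestronglyMeasurable
    (.of_forall fun ω => (Real.exp_pos _).le)).1 fun htop => ?_
  have ha := ENNReal.eq_inv_of_mul_eq_one_left hone
  simp [ha, htop] at hone

lemma eq_tilted_of_eq_smul_withDensity (hf : Measurable f)
    (h : P = a • Q.withDensity fun ω => ENNReal.ofReal (Real.exp (f ω))) : P = Q.tilted f := by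
  have : NeZero Q := ⟨fun hQ => IsProbabilityMeasure.ne_zero P (by simp [h, hQ])⟩
  have hint := integrable_exp_of_eq_smul_withDensity hf h
  rw [h, Measure.tilted, ← withDensity_smul _ hf.exp.ennreal_ofReal]
  congr 1
  ext ω
  rw [Pi.smul_apply, smul_eq_mul, ENNReal.ofReal_div_of_pos (integral_exp_pos hint),
    ofReal_integral_eq_lintegral_ofReal hint (.of_forall fun ω => (Real.exp_pos _).le),
    ENNReal.eq_inv_of_mul_eq_one_left (mul_lintegral_exp_eq_one h), mul_comm]
  rfl

lemma integral_nonpos_of_lintegral_exp_le_one (hf : Integrable f P)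
    (h : ∫⁻ ω, ENNReal.ofReal (Real.exp (f ω)) ∂P ≤ 1) : ∫ ω, f ω ∂P ≤ 0 := by
  have hexp_nonneg : 0 ≤ᵐ[P] fun ω => Real.exp (f ω) := .of_forall fun ω => (Real.exp_pos _).le
  have hmeas : AEStronglyMeasurable (fun ω => Real.exp (f ω)) P :=
    Real.continuous_exp.comp_aestronglyMeasurable hf.aestronglyMeasurable
  have hexp : Integrable (fun ω => Real.exp (f ω)) P :=
    (lintegral_ofReal_ne_top_iff_integrable hmeas hexp_nonneg).1
      (h.trans_lt ENNReal.one_lt_top).ne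
  have hle : ∫ ω, Real.exp (f ω) ∂P ≤ 1 := by
    rw [integral_eq_lintegral_of_nonneg_ae hexp_nonneg hmeas]
    exact ENNReal.toReal_le_of_le_ofReal zero_le_one (by simpa using h)
  have hmono : ∫ ω, (f ω + 1) ∂P ≤ ∫ ω, Real.exp (f ω) ∂P :=
    integral_mono (hf.add (integrable_const 1)) hexp fun ω => Real.add_one_le_exp (f ω)
  rw [integral_add hf (integrable_const 1)] at hmono
  simp only [integral_const, probReal_univ, one_smul] at hmono
  linarith

end Tilting

section Posterior

variable {π : E d → ℝ≥0∞}

/-- The (possibly improper) prior density `π` can be normalized after every observation, so that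
every `posterior σ π x` is a probability measure. -/
structure HasPosterior (σ : ℝ) (π : E d → ℝ≥0∞) : Prop where
  measurable : Measurable π
  marginal_ne_zero : ∀ x, marginal σ π x ≠ 0
  marginal_ne_top : ∀ x, marginal σ π x ≠ ∞

lemma hasPosterior_of_isSuperharmonic_marginal (hm : IsSuperharmonic (marginal σ π))
    (hσ : 0 < σ) (hπ : Measurable π) (hzero : ¬ π =ᵐ[volume] 0) : HasPosterior σ π where
  measurable := hπ
  marginal_ne_zero _ h := hzero ((marginal_eq_zero_iff hσ hπ).1 h)
  marginal_ne_top := marginal_ne_top_of_ae hπ hm.ae_ne_top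

lemma hasPosterior_one (hσ : 0 < σ) : HasPosterior σ (1 : E d → ℝ≥0∞) where
  measurable := measurable_one
  marginal_ne_zero x := by simp [marginal_one hσ]
  marginal_ne_top x := by simp [marginal_one hσ]

lemma posterior_one (hσ : 0 < σ) (x : E d) : posterior σ 1 x = law (normalDensity σ x) := by
  have h := marginal_one hσ x
  rw [marginal] at h
  simp_rw [posterior, h, inv_one, one_smul, law, Pi.one_apply, mul_one, normalDensity_comm _ x]

lemma measurable_posterior (hπ : Measurable π) : Measurable (posterior σ π) := by
  refine Measure.measurable_of_measurable_coe _ fun s hs => ?_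
  have hm : Measurable (Function.uncurry fun x μ : E d => normalDensity σ μ x * π μ) :=
    (measurable_uncurry_normalDensity.comp measurable_swap).mul (hπ.comp measurable_snd)
  simp only [posterior, Measure.smul_apply, smul_eq_mul, withDensity_apply _ hs]
  exact hm.lintegral_prod_right'.inv.mul hm.lintegral_prod_right'

lemma lintegral_posterior (hπ : Measurable π) {f : E d → ℝ≥0∞} (hf : Measurable f) (x : E d) :
    ∫⁻ μ, f μ ∂(posterior σ π x) =
      (marginal σ π x)⁻¹ * ∫⁻ μ, normalDensity σ μ x * π μ * f μ := by
  rw [posterior, lintegral_smul_measure,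
    lintegral_withDensity_eq_lintegral_mul _ (measurable_normalDensity_mul hπ x) hf]
  rfl

namespace HasPosterior

variable (hπ : HasPosterior σ π)
include hπ

lemma isProbabilityMeasure (x : E d) : IsProbabilityMeasure (posterior σ π x) := by
  constructor
  rw [posterior, Measure.smul_apply, withDensity_apply _ MeasurableSet.univ, setLIntegral_univ]
  exact ENNReal.inv_mul_cancel (hπ.marginal_ne_zero x) (hπ.marginal_ne_top x)

lemma stronglyMeasurable_integral {F : Type*} [NormedAddCommGroup F] [NormedSpace ℝ F]
    {f : E d → E d → F} (hf : StronglyMeasurable (Function.uncurry f)) :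
    StronglyMeasurable fun x => ∫ μ, f x μ ∂(posterior σ π x) := by
  let κ : Kernel (E d) (E d) := ⟨posterior σ π, measurable_posterior hπ.measurable⟩
  have : IsMarkovKernel κ := ⟨hπ.isProbabilityMeasure⟩
  exact hf.integral_kernel_prod_right (κ := κ)

lemma measurable_posteriorMean : Measurable (posteriorMean σ π) :=
  (hπ.stronglyMeasurable_integral (f := fun _ μ => μ)
    measurable_snd.stronglyMeasurable).measurable

lemma exists_posterior_add_eq_smul_withDensity (hσ : 0 < σ) (x v : E d) :
    ∃ a : ℝ≥0∞, posterior σ π (x + v) =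
      a • (posterior σ π x).withDensity fun μ => ENNReal.ofReal (Real.exp (⟪v, μ⟫ / σ ^ 2)) := by
  set K := ENNReal.ofReal (Real.exp (-(2 * ⟪x, v⟫ + ‖v‖ ^ 2) / (2 * σ ^ 2)))
  have hg : Measurable fun μ : E d => ENNReal.ofReal (Real.exp (⟪v, μ⟫ / σ ^ 2)) := by fun_prop
  have hφ := measurable_normalDensity_mul (σ := σ) hπ.measurable x
  have hdensity : (fun μ => normalDensity σ μ (x + v) * π μ) =
      K • ((fun μ => normalDensity σ μ x * π μ) *
        fun μ => ENNReal.ofReal (Real.exp (⟪v, μ⟫ / σ ^ 2))) := by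
    ext μ
    simp only [Pi.smul_apply, Pi.mul_apply, smul_eq_mul, normalDensity_add_right hσ]
    ring
  have hposterior : volume.withDensity (fun μ => normalDensity σ μ x * π μ) =
      marginal σ π x • posterior σ π x := by
    change _ = marginal σ π x • ((marginal σ π x)⁻¹ • _)
    rw [smul_smul, ENNReal.mul_inv_cancel (hπ.marginal_ne_zero x) (hπ.marginal_ne_top x), one_smul]
  refine ⟨(marginal σ π (x + v))⁻¹ * K * marginal σ π x, ?_⟩
  change (marginal σ π (x + v))⁻¹ • volume.withDensity _ = _
  rw [hdensity, withDensity_smul _ (hφ.mul hg), withDensity_mul _ hφ hg, hposterior,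
    withDensity_smul_measure, smul_smul, smul_smul]

lemma integrable_exp_inner (hσ : 0 < σ) (x v : E d) :
    Integrable (fun μ => Real.exp (⟪v, μ⟫ / σ ^ 2)) (posterior σ π x) := by
  have := hπ.isProbabilityMeasure (x + v)
  obtain ⟨a, ha⟩ := hπ.exists_posterior_add_eq_smul_withDensity hσ x v
  exact integrable_exp_of_eq_smul_withDensity (by fun_prop) ha

lemma posterior_add (hσ : 0 < σ) (x v : E d) :
    posterior σ π (x + v) = (posterior σ π x).tilted fun μ => ⟪v, μ⟫ / σ ^ 2 := by
  have := hπ.isProbabilityMeasure (x + v)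
  obtain ⟨a, ha⟩ := hπ.exists_posterior_add_eq_smul_withDensity hσ x v
  exact eq_tilted_of_eq_smul_withDensity (by fun_prop) ha

lemma integrableExpSet_inner (hσ : 0 < σ) (x v : E d) :
    integrableExpSet (fun μ => ⟪v, μ⟫) (posterior σ π x) = Set.univ := by
  refine Set.eq_univ_of_forall fun t => ?_
  refine (hπ.integrable_exp_inner hσ x ((σ ^ 2 * t) • v)).congr (.of_forall fun μ => ?_)
  simp only [real_inner_smul_left]
  congr 1
  field_simp

lemma mem_interior_integrableExpSet_inner (hσ : 0 < σ) (x v : E d) (t : ℝ) :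
    t ∈ interior (integrableExpSet (fun μ => ⟪v, μ⟫) (posterior σ π x)) := by
  simp [hπ.integrableExpSet_inner hσ]

lemma memLp_two (hσ : 0 < σ) (x : E d) : MemLp (fun μ => μ) 2 (posterior σ π x) := by
  refine MemLp.of_eval_piLp fun i => ?_
  simpa [EuclideanSpace.inner_single_left] using memLp_of_mem_interior_integrableExpSet
    (hπ.mem_interior_integrableExpSet_inner hσ x (EuclideanSpace.single i 1) 0) 2

lemma integrable_id (hσ : 0 < σ) (x : E d) : Integrable (fun μ => μ) (posterior σ π x) :=
  have := hπ.isProbabilityMeasure x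
  (hπ.memLp_two hσ x).integrable one_le_two

lemma integrable_norm_sub_sq (hσ : 0 < σ) (x c : E d) :
    Integrable (fun μ => ‖μ - c‖ ^ 2) (posterior σ π x) :=
  have := hπ.isProbabilityMeasure x
  ((hπ.memLp_two hσ x).sub (memLp_const c)).integrable_norm_pow two_ne_zero

lemma variance_inner_add_sq (hσ : 0 < σ) (x v c : E d) :
    Var[fun μ => ⟪v, μ⟫; posterior σ π x] + ⟪v, posteriorMean σ π x - c⟫ ^ 2 =
      ∫ μ, ⟪v, μ - c⟫ ^ 2 ∂(posterior σ π x) :=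
  have := hπ.isProbabilityMeasure x
  PredictiveDensity.variance_inner_add_sq (hπ.memLp_two hσ x) v c

lemma measurable_variance_inner (hσ : 0 < σ) (v : E d) :
    Measurable fun x => Var[fun μ => ⟪v, μ⟫; posterior σ π x] := by
  have hmeas : Measurable fun x => ∫ μ, ⟪v, μ - 0⟫ ^ 2 ∂(posterior σ π x) :=
    (hπ.stronglyMeasurable_integral (f := fun _ μ => ⟪v, μ - 0⟫ ^ 2)
      (Measurable.stronglyMeasurable (by fun_prop))).measurable
  have hmean := hπ.measurable_posteriorMean
  simp_rw [fun x => eq_sub_of_add_eq (hπ.variance_inner_add_sq hσ x v 0)]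
  fun_prop

lemma inner_posteriorMean_add (hσ : 0 < σ) (x v : E d) (t : ℝ) :
    ⟪v, posteriorMean σ π (x + t • v)⟫ =
      deriv (cgf (fun μ => ⟪v, μ⟫) (posterior σ π x)) (t / σ ^ 2) := by
  rw [posteriorMean, ← integral_inner (hπ.integrable_id hσ _), hπ.posterior_add hσ,
    ← integral_tilted_mul_self (hπ.mem_interior_integrableExpSet_inner hσ x v _)]
  simp only [real_inner_smul_left, div_mul_eq_mul_div]

/- Tweedie: a shift of the observation along `v` tilts the posterior by `⟪v, μ⟫ / σ ^ 2`, so the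
mean and its derivative are the first two derivatives of a cumulant generating function. -/
lemma hasLineDerivAt_inner_posteriorMean (hσ : 0 < σ) (x v : E d) :
    HasLineDerivAt ℝ (fun x => ⟪v, posteriorMean σ π x⟫)
      (Var[fun μ => ⟪v, μ⟫; posterior σ π x] / σ ^ 2) x v := by
  have := hπ.isProbabilityMeasure x
  have hmem := hπ.mem_interior_integrableExpSet_inner hσ x v
  set g := cgf (fun μ => ⟪v, μ⟫) (posterior σ π x)
  have hvar : Var[fun μ => ⟪v, μ⟫; posterior σ π x] = deriv (deriv g) 0 := by
    rw [← iteratedDeriv_one (f := g), ← iteratedDeriv_succ, ← variance_tilted_mul (hmem 0)]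
    simp
  have hderiv : HasDerivAt (deriv g) (deriv (deriv g) 0) (0 / σ ^ 2) := by
    rw [zero_div]
    exact (analyticAt_cgf (hmem 0)).deriv.differentiableAt.hasDerivAt
  unfold HasLineDerivAt
  simp_rw [hπ.inner_posteriorMean_add hσ, hvar, div_eq_mul_one_div (deriv (deriv g) 0)]
  have hlin : HasDerivAt (fun t : ℝ => t / σ ^ 2) (1 / σ ^ 2) 0 := (hasDerivAt_id 0).div_const _
  exact HasDerivAt.comp (0 : ℝ) (h₂ := deriv g) hderiv hlin

end HasPosterior

lemma marginal_sqrt_le (hm : IsSuperharmonic (marginal σ π)) (hπ : Measurable π) (hσ : 0 < σ)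
    (hτ : 0 < τ) (x : E d) : marginal √(σ ^ 2 + τ ^ 2) π x ≤ marginal σ π x := by
  rw [add_comm, ← marginal_marginal hτ hσ hπ]
  exact hm.marginal_le hτ x

/- The density ratio of `N(x, s² I)` and `N(x, σ² I)` has posterior mean
`marginal s π x / marginal σ π x ≤ 1`; Jensen's inequality for `exp` then bounds the posterior
mean of its logarithm. -/
lemma integral_norm_sub_sq_posterior_le_mul_add (hm : IsSuperharmonic (marginal σ π))
    (hπ : HasPosterior σ π) (hσ : 0 < σ) (hτ : 0 < τ) (x : E d) :
    ∫ μ, ‖μ - x‖ ^ 2 ∂(posterior σ π x) ≤ d * (σ ^ 2 + τ ^ 2) := by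
  have := hπ.isProbabilityMeasure x
  set s := √(σ ^ 2 + τ ^ 2) with hs
  have hs_pos : 0 < s := by positivity
  have hs_sq : s ^ 2 = σ ^ 2 + τ ^ 2 := Real.sq_sqrt (by positivity)
  have hk : 0 < (s ^ 2 - σ ^ 2) / (2 * σ ^ 2) := by
    rw [hs_sq, add_sub_cancel_left]
    positivity
  set k := (s ^ 2 - σ ^ 2) / (2 * σ ^ 2)
  have hint := (hπ.integrable_norm_sub_sq hσ x x).div_const (s ^ 2)
  have hratio : ∫⁻ μ, ENNReal.ofReal (Real.exp (k * (‖μ - x‖ ^ 2 / s ^ 2 - d)))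
      ∂(posterior σ π x) ≤ 1 := by
    rw [lintegral_posterior hπ.measurable (by fun_prop),
      ← ENNReal.inv_mul_cancel (hπ.marginal_ne_zero x) (hπ.marginal_ne_top x)]
    gcongr
    refine le_trans (lintegral_mono fun μ => ?_) (marginal_sqrt_le hm hπ.measurable hσ hτ x)
    rw [mul_right_comm, ← hs]
    gcongr
    exact normalDensity_mul_exp_le hσ hs_pos μ x
  have hnonpos : ∫ μ, k * (‖μ - x‖ ^ 2 / s ^ 2 - d) ∂(posterior σ π x) ≤ 0 :=
    integral_nonpos_of_lintegral_exp_le_one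
      ((hint.sub (integrable_const (d : ℝ))).const_mul k) hratio
  rw [integral_const_mul, integral_sub hint (integrable_const _), integral_div] at hnonpos
  simp only [integral_const, probReal_univ, one_smul] at hnonpos
  rw [← hs_sq, ← div_le_iff₀ (by positivity)]
  exact sub_nonpos.1 (nonpos_of_mul_nonpos_right hnonpos hk)

lemma integral_norm_sub_sq_posterior_le (hm : IsSuperharmonic (marginal σ π))
    (hπ : HasPosterior σ π) (hσ : 0 < σ) (x : E d) :
    ∫ μ, ‖μ - x‖ ^ 2 ∂(posterior σ π x) ≤ d * σ ^ 2 := by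
  have hlim : Tendsto (fun τ : ℝ => d * (σ ^ 2 + τ ^ 2)) (𝓝[>] 0) (𝓝 (d * σ ^ 2)) := by
    have hcont : Continuous fun τ : ℝ => d * (σ ^ 2 + τ ^ 2) := by fun_prop
    simpa using (hcont.tendsto 0).mono_left nhdsWithin_le_nhds
  exact ge_of_tendsto hlim (mem_of_superset self_mem_nhdsWithin fun τ hτ =>
    integral_norm_sub_sq_posterior_le_mul_add hm hπ hσ hτ x)

end Posterior

section Stein

lemma memLp_two_law_normalDensity (hσ : 0 < σ) (μ : E d) :
    MemLp (fun z => z) 2 (law (normalDensity σ μ)) := by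
  rw [← posterior_one hσ]
  exact (hasPosterior_one hσ).memLp_two hσ μ

variable {h h' : E d → ℝ} {μ v : E d}

lemma integral_inner_sub_mul_law_normalDensity (hσ : 0 < σ)
    (hderiv : ∀ z, HasLineDerivAt ℝ h (h' z) z v) (hh : MemLp h 2 (law (normalDensity σ μ)))
    (hh' : Integrable h' (law (normalDensity σ μ))) :
    ∫ z, ⟪v, z - μ⟫ * h z ∂(law (normalDensity σ μ)) =
      σ ^ 2 * ∫ z, h' z ∂(law (normalDensity σ μ)) := by
  have := isProbabilityMeasure_law_normalDensity hσ μ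
  have hi := hh.integrable one_le_two
  have hm := (((memLp_two_law_normalDensity hσ μ).sub (memLp_const μ)).const_inner v).integrable_mul
    hh
  rw [integrable_law_normalDensity_iff] at hi hh' hm
  have hm' : Integrable fun z : E d =>
      -⟪v, z - μ⟫ / σ ^ 2 * (normalDensity σ μ z).toReal * h z := by
    refine (hm.const_mul (-1 / σ ^ 2)).congr (.of_forall fun z => ?_)
    simp only [Pi.mul_apply, Pi.sub_apply]
    ring
  have hparts := integral_bilinear_hasLineDerivAt_right_eq_neg_left_of_integrable (μ := volume)
    (B := ContinuousLinearMap.mul ℝ ℝ) (v := v) hm' hh' hi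
    (fun z _ => hasLineDerivAt_normalDensity hσ μ z v) (fun z _ => hderiv z)
  simp only [ContinuousLinearMap.mul_apply'] at hparts
  rw [integral_law_normalDensity, integral_law_normalDensity, hparts, ← integral_neg,
    ← integral_const_mul]
  refine integral_congr_ae (.of_forall fun z => ?_)
  field_simp

lemma integral_id_law_normalDensity (hσ : 0 < σ) (μ : E d) :
    ∫ z, z ∂(law (normalDensity σ μ)) = μ := by
  have := isProbabilityMeasure_law_normalDensity hσ μ
  have hint := (memLp_two_law_normalDensity hσ μ).integrable one_le_two
  refine ext_inner_left ℝ fun v => ?_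
  have hstein := integral_inner_sub_mul_law_normalDensity (v := v) (h := fun _ => 1)
    (h' := fun _ => 0) hσ
    (fun z => by simpa [HasLineDerivAt] using hasDerivAt_const (0 : ℝ) (1 : ℝ)) (memLp_const 1)
    (integrable_const (μ := law (normalDensity σ μ)) 0)
  simp only [mul_one, integral_zero, mul_zero, inner_sub_right] at hstein
  rw [integral_sub (hint.const_inner v) (integrable_const _), integral_inner hint] at hstein
  simpa [sub_eq_zero] using hstein

lemma hasLineDerivAt_inner_sub (v c z : E d) :
    HasLineDerivAt ℝ (fun z => ⟪v, z - c⟫) (‖v‖ ^ 2) z v := by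
  rw [← real_inner_self_eq_norm_sq]
  exact ((innerSL ℝ v).hasFDerivAt.comp z ((hasFDerivAt_id z).sub_const c)).hasLineDerivAt v

lemma integral_inner_sub_sq_law_normalDensity (hσ : 0 < σ) (μ v : E d) :
    ∫ z, ⟪v, z - μ⟫ ^ 2 ∂(law (normalDensity σ μ)) = σ ^ 2 * ‖v‖ ^ 2 := by
  have := isProbabilityMeasure_law_normalDensity hσ μ
  simp_rw [sq ⟪v, _⟫]
  rw [integral_inner_sub_mul_law_normalDensity hσ (hasLineDerivAt_inner_sub v μ)
    (((memLp_two_law_normalDensity hσ μ).sub (memLp_const μ)).const_inner v) (integrable_const _)]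
  simp

lemma integral_norm_sub_sq_law_normalDensity (hσ : 0 < σ) (μ : E d) :
    ∫ z, ‖z - μ‖ ^ 2 ∂(law (normalDensity σ μ)) = d * σ ^ 2 := by
  have := isProbabilityMeasure_law_normalDensity hσ μ
  rw [integral_norm_sq_eq_sum_integral_inner_sq (X := fun z => z - μ)
    (EuclideanSpace.basisFun (Fin d) ℝ)
    ((memLp_two_law_normalDensity hσ μ).sub (memLp_const μ))]
  simp only [integral_inner_sub_sq_law_normalDensity hσ]
  simp

lemma integral_inner_sub_add_sq_law_normalDensity (hσ : 0 < σ)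
    (hderiv : ∀ z, HasLineDerivAt ℝ h (h' z) z v) (hh : MemLp h 2 (law (normalDensity σ μ)))
    (hh' : Integrable h' (law (normalDensity σ μ))) :
    ∫ z, (⟪v, z - μ⟫ + h z) ^ 2 ∂(law (normalDensity σ μ)) =
      σ ^ 2 * ‖v‖ ^ 2 + ∫ z, (2 * σ ^ 2 * h' z + h z ^ 2) ∂(law (normalDensity σ μ)) := by
  have := isProbabilityMeasure_law_normalDensity hσ μ
  have hz : MemLp (fun z => ⟪v, z - μ⟫) 2 (law (normalDensity σ μ)) :=
    ((memLp_two_law_normalDensity hσ μ).sub (memLp_const μ)).const_inner v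
  have hcross : Integrable (fun z => 2 * (⟪v, z - μ⟫ * h z)) (law (normalDensity σ μ)) :=
    (hz.integrable_mul hh).const_mul 2
  simp_rw [add_sq, mul_assoc]
  rw [integral_add (by exact hz.integrable_sq.add hcross) hh.integrable_sq,
    integral_add hz.integrable_sq hcross, integral_const_mul,
    integral_inner_sub_sq_law_normalDensity hσ,
    integral_inner_sub_mul_law_normalDensity hσ hderiv hh hh',
    integral_add ((hh'.const_mul _).const_mul 2) hh.integrable_sq, integral_const_mul,
    integral_const_mul, add_assoc]

end Stein

namespace HasPosterior

variable {π : E d → ℝ≥0∞} {C : ℝ} (hπ : HasPosterior σ π)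
include hπ

lemma norm_posteriorMean_sub_sq_le (hσ : 0 < σ) (x c : E d) :
    ‖posteriorMean σ π x - c‖ ^ 2 ≤ ∫ μ, ‖μ - c‖ ^ 2 ∂(posterior σ π x) := by
  have := hπ.isProbabilityMeasure x
  rw [integral_norm_sub_sq (hπ.memLp_two hσ x) c]
  exact le_add_of_nonneg_left (by positivity)

lemma sum_variance_inner_add_sq {ι : Type*} [Fintype ι] (b : OrthonormalBasis ι ℝ (E d))
    (hσ : 0 < σ) (x c : E d) :
    ∑ i, (Var[fun μ => ⟪b i, μ⟫; posterior σ π x] + ⟪b i, posteriorMean σ π x - c⟫ ^ 2) =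
      ∫ μ, ‖μ - c‖ ^ 2 ∂(posterior σ π x) := by
  have := hπ.isProbabilityMeasure x
  simp_rw [hπ.variance_inner_add_sq hσ]
  exact (integral_norm_sq_eq_sum_integral_inner_sq (X := fun μ => μ - c) b
    ((hπ.memLp_two hσ x).sub (memLp_const c))).symm

lemma variance_inner_le (hσ : 0 < σ) (x v c : E d) :
    Var[fun μ => ⟪v, μ⟫; posterior σ π x] ≤ ‖v‖ ^ 2 * ∫ μ, ‖μ - c‖ ^ 2 ∂(posterior σ π x) := by
  have := hπ.isProbabilityMeasure x
  refine (le_add_of_nonneg_right (sq_nonneg _)).trans_eq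
    (hπ.variance_inner_add_sq hσ x v c) |>.trans ?_
  rw [← integral_const_mul]
  refine integral_mono
    (((hπ.memLp_two hσ x).sub (memLp_const c)).const_inner v).integrable_sq
    ((hπ.integrable_norm_sub_sq hσ x c).const_mul _) fun μ => ?_
  rw [← mul_pow, ← sq_abs]
  gcongr
  exact abs_real_inner_le_norm v (μ - c)

lemma hasLineDerivAt_inner_posteriorMean_sub (hσ : 0 < σ) (x v : E d) :
    HasLineDerivAt ℝ (fun x => ⟪v, posteriorMean σ π x - x⟫)
      (Var[fun μ => ⟪v, μ⟫; posterior σ π x] / σ ^ 2 - ‖v‖ ^ 2) x v := by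
  have hmean := hπ.hasLineDerivAt_inner_posteriorMean hσ x v
  have hid := hasLineDerivAt_inner_sub v 0 x
  unfold HasLineDerivAt at hmean hid ⊢
  simp_rw [sub_zero] at hid
  simp_rw [inner_sub_right]
  exact hmean.fun_sub hid

section BoundedSecondMoment

variable (hC : ∀ x, ∫ μ, ‖μ - x‖ ^ 2 ∂(posterior σ π x) ≤ C)
include hC

lemma memLp_two_posteriorMean_sub (hσ : 0 < σ) (θ : E d) :
    MemLp (fun x => posteriorMean σ π x - x) 2 (law (normalDensity σ θ)) := by
  have := isProbabilityMeasure_law_normalDensity hσ θ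
  have hm := hπ.measurable_posteriorMean
  exact MemLp.of_bound (by fun_prop) √C (.of_forall fun x =>
    Real.le_sqrt_of_sq_le ((hπ.norm_posteriorMean_sub_sq_le hσ x x).trans (hC x)))

lemma memLp_two_posteriorMean_sub_const (hσ : 0 < σ) (θ c : E d) :
    MemLp (fun x => posteriorMean σ π x - c) 2 (law (normalDensity σ θ)) := by
  have := isProbabilityMeasure_law_normalDensity hσ θ
  refine ((hπ.memLp_two_posteriorMean_sub hC hσ θ).add
    ((memLp_two_law_normalDensity hσ θ).sub (memLp_const c))).ae_eq (.of_forall fun x => ?_)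
  simp

lemma integrable_variance_inner (hσ : 0 < σ) (θ v : E d) :
    Integrable (fun x => Var[fun μ => ⟪v, μ⟫; posterior σ π x]) (law (normalDensity σ θ)) := by
  have := isProbabilityMeasure_law_normalDensity hσ θ
  refine .of_bound (hπ.measurable_variance_inner hσ v).aestronglyMeasurable (‖v‖ ^ 2 * C)
    (.of_forall fun x => ?_)
  rw [Real.norm_of_nonneg (variance_nonneg _ _)]
  exact (hπ.variance_inner_le hσ x v x).trans (by gcongr; exact hC x)

lemma integral_inner_posteriorMean_sub_sq (hσ : 0 < σ) (θ v : E d) :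
    ∫ x, ⟪v, posteriorMean σ π x - θ⟫ ^ 2 ∂(law (normalDensity σ θ)) =
      ∫ x, (2 * Var[fun μ => ⟪v, μ⟫; posterior σ π x] + ⟪v, posteriorMean σ π x - x⟫ ^ 2)
        ∂(law (normalDensity σ θ)) - σ ^ 2 * ‖v‖ ^ 2 := by
  have := isProbabilityMeasure_law_normalDensity hσ θ
  have hbias := (hπ.memLp_two_posteriorMean_sub hC hσ θ).const_inner (𝕜 := ℝ) v
  have hvar := hπ.integrable_variance_inner hC hσ θ v
  have hrisk := integral_inner_sub_add_sq_law_normalDensity hσ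
    (fun x => hπ.hasLineDerivAt_inner_posteriorMean_sub hσ x v) hbias
    ((hvar.div_const _).sub (integrable_const _))
  have hsplit (x : E d) : ⟪v, posteriorMean σ π x - θ⟫ =
      ⟪v, x - θ⟫ + ⟪v, posteriorMean σ π x - x⟫ := by
    rw [← inner_add_right, add_comm, sub_add_sub_cancel]
  have hestimate (x : E d) :
      2 * σ ^ 2 * (Var[fun μ => ⟪v, μ⟫; posterior σ π x] / σ ^ 2 - ‖v‖ ^ 2) +
        ⟪v, posteriorMean σ π x - x⟫ ^ 2 =
      2 * Var[fun μ => ⟪v, μ⟫; posterior σ π x] + ⟪v, posteriorMean σ π x - x⟫ ^ 2 -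
        2 * (σ ^ 2 * ‖v‖ ^ 2) := by
    field_simp
    ring
  simp_rw [hsplit, hrisk, hestimate]
  rw [integral_sub (by exact (hvar.const_mul 2).add hbias.integrable_sq) (integrable_const _)]
  simp only [integral_const, probReal_univ, one_smul]
  ring

lemma integral_norm_posteriorMean_sub_sq_le (hσ : 0 < σ) (θ : E d) :
    ∫ x, ‖posteriorMean σ π x - θ‖ ^ 2 ∂(law (normalDensity σ θ)) ≤ 2 * C - d * σ ^ 2 := by
  have := isProbabilityMeasure_law_normalDensity hσ θ
  let b := EuclideanSpace.basisFun (Fin d) ℝ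
  have hint (i : Fin d) : Integrable (fun x => 2 * Var[fun μ => ⟪b i, μ⟫; posterior σ π x] +
      ⟪b i, posteriorMean σ π x - x⟫ ^ 2) (law (normalDensity σ θ)) :=
    ((hπ.integrable_variance_inner hC hσ θ (b i)).const_mul 2).add
      ((hπ.memLp_two_posteriorMean_sub hC hσ θ).const_inner (b i)).integrable_sq
  rw [integral_norm_sq_eq_sum_integral_inner_sq b
    (hπ.memLp_two_posteriorMean_sub_const hC hσ θ θ)]
  simp_rw [hπ.integral_inner_posteriorMean_sub_sq hC hσ, b.norm_eq_one]
  rw [Finset.sum_sub_distrib, ← integral_finsetSum _ fun i _ => hint i]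
  have hle : ∫ x, ∑ i, (2 * Var[fun μ => ⟪b i, μ⟫; posterior σ π x] +
      ⟪b i, posteriorMean σ π x - x⟫ ^ 2) ∂(law (normalDensity σ θ)) ≤
        ∫ _, 2 * C ∂(law (normalDensity σ θ)) := by
    refine integral_mono (integrable_finsetSum _ fun i _ => hint i) (integrable_const _)
      fun x => ?_
    refine le_trans ?_ (mul_le_mul_of_nonneg_left (hC x) zero_le_two)
    rw [← hπ.sum_variance_inner_add_sq b hσ, Finset.mul_sum]
    gcongr with i
    nlinarith [sq_nonneg ⟪b i, posteriorMean σ π x - x⟫]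
  simp only [integral_const, probReal_univ, one_smul] at hle
  simpa using hle

end BoundedSecondMoment

end HasPosterior

section Loss

lemma loss_normalDensity_le (hσ : 0 < σ) (μ ν : E d) :
    loss σ μ (normalDensity σ ν) ≤ ‖μ - ν‖ₑ ^ 2 := by
  have := isProbabilityMeasure_law_normalDensity hσ μ
  have h := wassersteinTwo_sq_map_add_right_le (P := law (normalDensity σ μ)) (ν - μ)
  rwa [map_add_law_normalDensity, add_sub_cancel, ← enorm_neg, neg_sub] at h

lemma memLp_two_law_of_loss_ne_top (hσ : 0 < σ) {μ : E d} {q : E d → ℝ≥0∞}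
    (h : loss σ μ q ≠ ∞) : MemLp id 2 (law q) :=
  memLp_two_of_wassersteinTwo_sq_ne_top (memLp_two_law_normalDensity hσ μ) h

lemma loss_eq_add (hσ : 0 < σ) {q : E d → ℝ≥0∞} (hq : MemLp id 2 (law q)) (μ : E d) :
    loss σ μ q = loss σ (∫ z, z ∂(law q)) q + ‖μ - ∫ z, z ∂(law q)‖ₑ ^ 2 := by
  have := isProbabilityMeasure_law_normalDensity hσ μ
  have h := wassersteinTwo_sq_eq_add (memLp_two_law_normalDensity hσ μ) hq
  rwa [integral_id_law_normalDensity hσ, map_add_law_normalDensity, add_sub_cancel] at h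

lemma enorm_sub_sq_le_loss (hσ : 0 < σ) (μ : E d) (q : E d → ℝ≥0∞) :
    ‖μ - ∫ z, z ∂(law q)‖ₑ ^ 2 ≤ loss σ μ q := by
  by_cases h : loss σ μ q = ∞
  · simp [h]
  · rw [loss_eq_add hσ (memLp_two_law_of_loss_ne_top hσ h)]
    exact le_add_self

variable {P : Measure (E d)} [IsProbabilityMeasure P] {q : E d → ℝ≥0∞}

lemma lintegral_loss_normalDensity_le (hσ : 0 < σ) (hP : MemLp (fun μ => μ) 2 P)
    (q : E d → ℝ≥0∞) :
    ∫⁻ μ, loss σ μ (normalDensity σ (∫ u, u ∂P)) ∂P ≤ ∫⁻ μ, loss σ μ q ∂P :=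
  calc ∫⁻ μ, loss σ μ (normalDensity σ (∫ u, u ∂P)) ∂P
      ≤ ∫⁻ μ, ‖μ - ∫ u, u ∂P‖ₑ ^ 2 ∂P := lintegral_mono fun μ => loss_normalDensity_le hσ μ _
    _ ≤ ∫⁻ μ, ‖μ - ∫ z, z ∂(law q)‖ₑ ^ 2 ∂P := by
        rw [lintegral_enorm_sub_sq hP (∫ z, z ∂(law q))]
        exact le_self_add
    _ ≤ ∫⁻ μ, loss σ μ q ∂P := lintegral_mono fun μ => enorm_sub_sq_le_loss hσ μ q

lemma lintegral_loss_eq_add (hσ : 0 < σ) (hP : MemLp (fun μ => μ) 2 P)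
    (hq : MemLp id 2 (law q)) :
    ∫⁻ μ, loss σ μ q ∂P = ∫⁻ μ, ‖μ - ∫ u, u ∂P‖ₑ ^ 2 ∂P + loss σ (∫ u, u ∂P) q := by
  rw [lintegral_congr (loss_eq_add hσ hq), lintegral_add_left measurable_const, lintegral_const,
    measure_univ, mul_one, lintegral_enorm_sub_sq hP (∫ z, z ∂(law q)), add_left_comm,
    ← loss_eq_add hσ hq]

lemma loss_eq_of_lintegral_loss_le (hσ : 0 < σ) (hP : MemLp (fun μ => μ) 2 P)
    (hle : ∫⁻ μ, loss σ μ q ∂P ≤ ∫⁻ μ, loss σ μ (normalDensity σ (∫ u, u ∂P)) ∂P) (μ : E d) :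
    loss σ μ q = ‖μ - ∫ u, u ∂P‖ₑ ^ 2 := by
  have hfin : ∫⁻ μ, ‖μ - ∫ u, u ∂P‖ₑ ^ 2 ∂P ≠ ∞ := by
    rw [lintegral_enorm_sq_eq_ofReal_integral (X := fun μ => μ - ∫ u, u ∂P)
      (hP.sub (memLp_const _))]
    exact ENNReal.ofReal_ne_top
  replace hle : ∫⁻ μ, loss σ μ q ∂P ≤ ∫⁻ μ, ‖μ - ∫ u, u ∂P‖ₑ ^ 2 ∂P :=
    hle.trans (lintegral_mono fun μ => loss_normalDensity_le hσ μ _)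
  have hq : MemLp id 2 (law q) := by
    obtain ⟨ν, hν⟩ : ∃ ν, loss σ ν q ≠ ∞ := by
      by_contra! htop
      simp only [htop, lintegral_const, measure_univ, mul_one, top_le_iff] at hle
      exact hfin hle
    exact memLp_two_law_of_loss_ne_top hσ hν
  have hzero : loss σ (∫ u, u ∂P) q = 0 := by
    rw [lintegral_loss_eq_add hσ hP hq] at hle
    exact le_zero_iff.1 ((ENNReal.add_le_add_iff_left hfin).1 (hle.trans_eq (add_zero _).symm))
  rw [loss_eq_add hσ hq, add_eq_zero] at hzero
  have hmean : ∫ u, u ∂P = ∫ z, z ∂(law q) := by simpa [sub_eq_zero] using hzero.2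
  rw [loss_eq_add hσ hq, hzero.1, zero_add, hmean]

end Loss

section Risk

/-- The mean of the predictive density announced after `x` has been observed, as an estimator of the
mean of the future observation. -/
noncomputable def predictiveMean (p : E d → E d → ℝ≥0∞) (x : E d) : E d :=
  ∫ z, z ∂(law (p x))

/-- The risk at `θ` of the estimator `δ` under squared error loss, for `x ∼ N_d(θ, σ² I_d)`. -/
noncomputable def quadraticRisk (σ : ℝ) (θ : E d) (δ : E d → E d) : ℝ≥0∞ :=
  ∫⁻ x, ‖θ - δ x‖ₑ ^ 2 * normalDensity σ θ x

variable {p : E d → E d → ℝ≥0∞} {δ : E d → E d} {π : E d → ℝ≥0∞}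

lemma isPredictiveDensity_plugIn (hσ : 0 < σ) (hδ : Measurable δ) :
    IsPredictiveDensity (plugIn σ δ) where
  measurable := by
    have hcomp : Function.uncurry (plugIn σ δ) =
      Function.uncurry (normalDensity σ) ∘ fun z : E d × E d => (δ z.1, z.2) := rfl
    rw [hcomp]
    exact measurable_uncurry_normalDensity.comp ((hδ.comp measurable_fst).prodMk measurable_snd)
  lintegral_eq_one x := lintegral_normalDensity hσ (δ x)

lemma IsPredictiveDensity.isDensity (hp : IsPredictiveDensity p) (x : E d) : IsDensity (p x) :=
  ⟨hp.measurable.of_uncurry_left, hp.lintegral_eq_one x⟩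

lemma IsPredictiveDensity.measurable_predictiveMean (hp : IsPredictiveDensity p) :
    Measurable (predictiveMean p) := by
  have hmean (x : E d) : predictiveMean p x = ∫ z, (p x z).toReal • z :=
    integral_withDensity_eq_integral_toReal_smul (hp.isDensity x).measurable
      (ae_lt_top (hp.isDensity x).measurable (by simp [hp.lintegral_eq_one x])) _
  have hm : Measurable (Function.uncurry fun x z : E d => (p x z).toReal • z) :=
    hp.measurable.ennreal_toReal.smul measurable_snd
  rw [funext hmean]
  exact hm.stronglyMeasurable.integral_prod_right.measurable

lemma quadraticRisk_predictiveMean_le_risk (hσ : 0 < σ) (θ : E d) (p : E d → E d → ℝ≥0∞) :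
    quadraticRisk σ θ (predictiveMean p) ≤ risk σ θ p :=
  lintegral_mono fun x => mul_le_mul_left (enorm_sub_sq_le_loss hσ θ (p x)) _

lemma quadraticRisk_eq_ofReal_integral (hδ : Measurable δ) (θ : E d)
    (hL : MemLp (fun x => δ x - θ) 2 (law (normalDensity σ θ))) :
    quadraticRisk σ θ δ =
      ENNReal.ofReal (∫ x, ‖δ x - θ‖ ^ 2 ∂(law (normalDensity σ θ))) := by
  rw [← lintegral_enorm_sq_eq_ofReal_integral hL, quadraticRisk,
    lintegral_law (measurable_normalDensity θ) (by fun_prop)]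
  simp_rw [fun x => enorm_sub_rev θ (δ x)]

lemma HasPosterior.quadraticRisk_posteriorMean_le (hπ : HasPosterior σ π) (hσ : 0 < σ)
    {C : ℝ} (hC : ∀ x, ∫ μ, ‖μ - x‖ ^ 2 ∂(posterior σ π x) ≤ C) (θ : E d) :
    quadraticRisk σ θ (posteriorMean σ π) ≤ ENNReal.ofReal (2 * C - d * σ ^ 2) := by
  rw [quadraticRisk_eq_ofReal_integral hπ.measurable_posteriorMean θ
    (hπ.memLp_two_posteriorMean_sub_const hC hσ θ θ)]
  exact ENNReal.ofReal_le_ofReal (hπ.integral_norm_posteriorMean_sub_sq_le hC hσ θ)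

lemma HasPosterior.isBayes_plugIn_posteriorMean (hπ : HasPosterior σ π) (hσ : 0 < σ) :
    IsBayes σ π (plugIn σ (posteriorMean σ π)) :=
  ⟨isPredictiveDensity_plugIn hσ hπ.measurable_posteriorMean, .of_forall fun x q _ =>
    have := hπ.isProbabilityMeasure x
    lintegral_loss_normalDensity_le hσ (hπ.memLp_two hσ x) q⟩

lemma IsBayes.risk_eq_quadraticRisk (hp : IsBayes σ π p) (hπ : HasPosterior σ π) (hσ : 0 < σ)
    (θ : E d) : risk σ θ p = quadraticRisk σ θ (posteriorMean σ π) := by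
  refine lintegral_congr_ae ?_
  filter_upwards [hp.2] with x hx
  have := hπ.isProbabilityMeasure x
  rw [loss_eq_of_lintegral_loss_le hσ (hπ.memLp_two hσ x)
    (hx _ (isDensity_normalDensity hσ _)) θ, posteriorMean]

end Risk

section LowerBound

variable {δ : E d → E d}

lemma ofReal_le_lintegral_enorm_sub_sq_mul_normalDensity (hσ : 0 < σ) (b c : E d) :
    ENNReal.ofReal (d * σ ^ 2) ≤ ∫⁻ μ, ‖μ - c‖ₑ ^ 2 * normalDensity σ b μ := by
  have := isProbabilityMeasure_law_normalDensity hσ b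
  have hL := memLp_two_law_normalDensity hσ b
  rw [← lintegral_law (measurable_normalDensity b) (by fun_prop), lintegral_enorm_sub_sq hL c,
    integral_id_law_normalDensity hσ,
    lintegral_enorm_sq_eq_ofReal_integral (X := fun μ => μ - b) (hL.sub (memLp_const b)),
    integral_norm_sub_sq_law_normalDensity hσ]
  exact le_self_add

lemma ofReal_le_lintegral_quadraticRisk_mul_normalDensity (hσ : 0 < σ) (hτ : 0 < τ)
    (hδ : Measurable δ) :
    ENNReal.ofReal (d * (σ * τ / √(σ ^ 2 + τ ^ 2)) ^ 2) ≤
      ∫⁻ θ, quadraticRisk σ θ δ * normalDensity τ 0 θ := by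
  set s := √(σ ^ 2 + τ ^ 2)
  have hs : 0 < s := by positivity
  have hs_sq : s ^ 2 = σ ^ 2 + τ ^ 2 := Real.sq_sqrt (by positivity)
  set ρ := σ * τ / s with hρ
  have hm : Measurable (Function.uncurry fun x θ : E d =>
      ‖θ - δ x‖ₑ ^ 2 * normalDensity σ θ x * normalDensity τ 0 θ) := by
    refine (Measurable.mul ?_ (measurable_uncurry_normalDensity.comp measurable_swap)).mul
      ((measurable_normalDensity 0).comp measurable_snd)
    fun_prop
  have hposterior (x : E d) : normalDensity s 0 x * ENNReal.ofReal (d * ρ ^ 2) ≤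
      ∫⁻ θ, ‖θ - δ x‖ₑ ^ 2 * normalDensity σ θ x * normalDensity τ 0 θ := by
    simp_rw [mul_assoc, normalDensity_mul_normalDensity hσ hτ hs hs_sq hρ x 0,
      mul_left_comm (_ ^ 2)]
    rw [lintegral_const_mul' _ _ (normalDensity_ne_top _ _)]
    gcongr
    exact ofReal_le_lintegral_enorm_sub_sq_mul_normalDensity (by positivity) _ _
  calc ENNReal.ofReal (d * ρ ^ 2)
      = ∫⁻ x, normalDensity s 0 x * ENNReal.ofReal (d * ρ ^ 2) := by
        rw [lintegral_mul_const _ (measurable_normalDensity (0 : E d)),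
          lintegral_normalDensity hs, one_mul]
    _ ≤ ∫⁻ x, ∫⁻ θ, ‖θ - δ x‖ₑ ^ 2 * normalDensity σ θ x * normalDensity τ 0 θ :=
        lintegral_mono hposterior
    _ = ∫⁻ θ, ∫⁻ x, ‖θ - δ x‖ₑ ^ 2 * normalDensity σ θ x * normalDensity τ 0 θ :=
        lintegral_lintegral_swap hm.aemeasurable
    _ = ∫⁻ θ, quadraticRisk σ θ δ * normalDensity τ 0 θ := by
        refine lintegral_congr fun θ => ?_
        rw [lintegral_mul_const' _ _ (normalDensity_ne_top _ _), quadraticRisk]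

lemma lintegral_mul_normalDensity_le_iSup (hσ : 0 < σ) (f : E d → ℝ≥0∞) (μ : E d) :
    ∫⁻ z, f z * normalDensity σ μ z ≤ ⨆ z, f z :=
  calc ∫⁻ z, f z * normalDensity σ μ z
      ≤ ∫⁻ z, (⨆ z, f z) * normalDensity σ μ z := by gcongr with z; exact le_iSup f z
    _ = ⨆ z, f z := by
      rw [lintegral_const_mul _ (measurable_normalDensity μ), lintegral_normalDensity hσ, mul_one]

lemma ofReal_le_iSup_quadraticRisk (hσ : 0 < σ) (hδ : Measurable δ) :
    ENNReal.ofReal (d * σ ^ 2) ≤ ⨆ θ, quadraticRisk σ θ δ := by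
  have hlim : Tendsto (fun ε : ℝ => ENNReal.ofReal (d * (σ ^ 2 / (1 + σ ^ 2 * ε ^ 2))))
      (𝓝[>] 0) (𝓝 (ENNReal.ofReal (d * σ ^ 2))) := by
    have hcont : Continuous fun ε : ℝ => d * (σ ^ 2 / (1 + σ ^ 2 * ε ^ 2)) := by
      fun_prop (disch := intro; positivity)
    refine (ENNReal.tendsto_ofReal ?_).mono_left nhdsWithin_le_nhds
    simpa using hcont.tendsto 0
  refine le_of_tendsto hlim (mem_of_superset self_mem_nhdsWithin fun ε (hε : 0 < ε) => ?_)
  have hvar : (σ * ε⁻¹ / √(σ ^ 2 + ε⁻¹ ^ 2)) ^ 2 = σ ^ 2 / (1 + σ ^ 2 * ε ^ 2) := by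
    rw [div_pow, Real.sq_sqrt (by positivity)]
    field_simp
    ring
  have hprior := ofReal_le_lintegral_quadraticRisk_mul_normalDensity hσ (inv_pos.2 hε) hδ
  rw [hvar] at hprior
  exact hprior.trans (lintegral_mul_normalDensity_le_iSup (inv_pos.2 hε) _ 0)

end LowerBound

section Minimax

variable {π : E d → ℝ≥0∞} {p : E d → E d → ℝ≥0∞}

lemma IsBayes.isMinimax (hp : IsBayes σ π p) (hm : IsSuperharmonic (marginal σ π))
    (hπ : HasPosterior σ π) (hσ : 0 < σ) : IsMinimax σ p := by
  refine ⟨hp.1, fun q hq => ?_⟩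
  calc ⨆ θ, risk σ θ p
      = ⨆ θ, quadraticRisk σ θ (posteriorMean σ π) :=
        iSup_congr (hp.risk_eq_quadraticRisk hπ hσ)
    _ ≤ ENNReal.ofReal (2 * (d * σ ^ 2) - d * σ ^ 2) := iSup_le <|
        hπ.quadraticRisk_posteriorMean_le hσ (integral_norm_sub_sq_posterior_le hm hπ hσ)
    _ = ENNReal.ofReal (d * σ ^ 2) := by rw [two_mul, add_sub_cancel_right]
    _ ≤ ⨆ θ, quadraticRisk σ θ (predictiveMean q) :=
        ofReal_le_iSup_quadraticRisk hσ hq.measurable_predictiveMean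
    _ ≤ ⨆ θ, risk σ θ q := iSup_mono fun θ => quadraticRisk_predictiveMean_le_risk hσ θ q

end Minimax

end PredictiveDensity

open PredictiveDensity in
theorem mainTheorem10_general {d : ℕ} {σ : ℝ} {π : E d → ℝ≥0∞} (hσ : 0 < σ) (hπ : Measurable π)
    (hm : IsSuperharmonic (marginal σ π)) (hπ0 : ¬ π =ᵐ[volume] 0) :
    (∀ x, IsProbabilityMeasure (posterior σ π x) ∧ Integrable (fun μ => μ) (posterior σ π x)) ∧
    IsBayes σ π (plugIn σ (posteriorMean σ π)) ∧ ∀ p, IsBayes σ π p → IsMinimax σ p := by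
  have h := hasPosterior_of_isSuperharmonic_marginal hm hσ hπ hπ0
  exact ⟨fun x => ⟨h.isProbabilityMeasure x, h.integrable_id hσ x⟩,
    h.isBayes_plugIn_posteriorMean hσ, fun p hp => hp.isMinimax hm h hσ⟩

theorem mainTheorem10 (d : ℕ) (hd : 1 ≤ d) (σ : ℝ) (hσ : 0 < σ) (π : PredictiveDensity.E d → ℝ≥0∞)
    (hπ : PredictiveDensity.IsSuperharmonic π) (hπ0 : ∃ μ, π μ ≠ 0) :
    (∀ x, IsProbabilityMeasure (PredictiveDensity.posterior σ π x) ∧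
      Integrable (fun μ => μ) (PredictiveDensity.posterior σ π x)) ∧
    PredictiveDensity.IsBayes σ π
      (PredictiveDensity.plugIn σ (PredictiveDensity.posteriorMean σ π)) ∧
    ∀ p : PredictiveDensity.E d → PredictiveDensity.E d → ℝ≥0∞,
      PredictiveDensity.IsBayes σ π p → PredictiveDensity.IsMinimax σ p :=
  mainTheorem10_general hσ hπ.measurable (hπ.marginal hσ) (hπ.not_ae_eq_zero hπ0)
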